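/- Consider the initial value problem $$iu_t+u_{xx}=u\bar u,\qquad u(x,0)=u_0(x),\qquad x\in\mathbb R, \tag{$*$}$$ and write $\|f\|_{H^s}=\|(1+\xi^2)^{s/2}\hat f\|_{L^2(\mathbb R)}$. For Schwartz data $u_0$, a smooth solution of $(*)$ on $[0,T]$ is a function $u\in C([0,T];H^\sigma(\mathbb R))$ for every $\sigma\in\mathbb R$ with $u(0)=u_0$ that satisfies the equation on $[0,T]$, tested against Schwartz functions of $x$; the solution operator on $[0,T]$ is the map $u_0\mapsto u$, defined for those Schwartz data whose smooth solution exists up to time $T$. The problem $(*)$ is called locally well-posed in $H^s(\mathbb R)$ if around each $f\in H^s(\mathbb R)$ there are a ball $B\subset H^s(\mathbb R)$ and a time $T>0$ such that every Schwartz datum in $B$ has exactly one smooth solution on $[0,T]$ and the solution operator on these data extends to a continuous map $\Phi:(B,\|\cdot\|_{H^s})\to C([0,T];H^s(\mathbb R))$ with $\Phi(g)(0)=g$ for all $g\in B$. **Theorem 1.1** (ill-posedness below $H^{-1/4}(\mathbb R)$). Let $s<-\tfrac14$. Then $(*)$ is not locally well-posed in $H^s(\mathbb R)$. More precisely, the solution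 operator fails to be uniformly continuous with respect to the $H^s$ norm: for every $T>0$ and every $R\in(0,\infty]$, the solution operator on $[0,T]$, restricted to the Schwartz data with $\|u_0\|_{H^s}\le R$ in its domain, is not uniformly continuous from the $H^s$ norm to the $C([0,T];H^s)$ norm. -/

import Mathlib

open MeasureTheory Set Filter Topology TemperedDistribution
open scoped SchwartzMap ENNReal ComplexConjugate

noncomputable section

/-- The `H^s(ℝ)` norm of a tempered distribution `f`, with value `∞` when `f ∉ H^s(ℝ)`: the `L²`
norm of the (unique, if it exists) `L²` function that represents
`𝓕⁻ ((1 + ξ²)^(s/2) 𝓕 f)`. -/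
def sobolevENorm (s : ℝ) (f : 𝓢'(ℝ, ℂ)) : ℝ≥0∞ :=
  ⨅ (g : Lp ℂ 2 (volume : Measure ℝ))
    (_ : besselPotential ℝ ℂ s f = Lp.toTemperedDistribution g), ‖g‖ₑ

/-- `v ∈ C([0,T]; H^s(ℝ))`. -/
def ContinuousInSobolev (s T : ℝ) (v : ℝ → 𝓢'(ℝ, ℂ)) : Prop :=
  ∀ t ∈ Icc 0 T, MemSobolev s 2 (v t) ∧
    Tendsto (fun τ => sobolevENorm s (v τ - v t)) (𝓝[Icc 0 T] t) (𝓝 0)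

/-- `u` is a smooth solution on `[0,T]` of the initial value problem
`i u_t + u_xx = u ū`, `u(0) = u₀`: it lies in `C([0,T]; H^σ(ℝ))` for every `σ`, it takes the initial
value `u₀`, and tested against any Schwartz function of `x` it satisfies
`u_t = i (u_xx - u ū)` at every time of `[0,T]` (one-sidedly at the two end points). -/
structure IsSmoothSolution (T : ℝ) (u₀ : 𝓢(ℝ, ℂ))
    (u : ℝ → Lp ℂ 2 (volume : Measure ℝ)) : Prop where
  regular : ∀ σ : ℝ, ContinuousInSobolev σ T (fun t => Lp.toTemperedDistribution (u t))
  initial : u 0 = u₀.toLp 2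
  equation : ∀ φ : 𝓢(ℝ, ℂ), ∀ t ∈ Icc 0 T,
    HasDerivWithinAt (fun τ => ∫ x, u τ x * φ x)
      (Complex.I * ((∫ x, u t x * iteratedDeriv 2 φ x) - ∫ x, u t x * conj (u t x) * φ x))
      (Icc 0 T) t

/-- Local well-posedness of the initial value problem `i u_t + u_xx = u ū`, `u(0) = u₀` in
`H^s(ℝ)`: around each `f ∈ H^s(ℝ)` there are a ball `B` in `H^s(ℝ)` and a time `T > 0` such that
for every Schwartz datum in `B` there is exactly one smooth solution on `[0,T]`, and the resulting
solution operator extends to a continuous map `Φ` from `B`, with the `H^s` norm, to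
`C([0,T]; H^s(ℝ))`. -/
def LocallyWellPosed (s : ℝ) : Prop :=
  ∀ f : 𝓢'(ℝ, ℂ), MemSobolev s 2 f →
    ∃ r : ℝ≥0∞, 0 < r ∧ ∃ T : ℝ, 0 < T ∧ ∃ Φ : 𝓢'(ℝ, ℂ) → ℝ → 𝓢'(ℝ, ℂ),
      -- for data in the ball, `Φ g` is a curve in `C([0,T]; H^s)` that starts at `g`
      (∀ g, sobolevENorm s (g - f) < r → ContinuousInSobolev s T (Φ g) ∧ Φ g 0 = g) ∧
      -- continuous dependence on the data
      (∀ g, sobolevENorm s (g - f) < r → ∀ ε : ℝ≥0∞, 0 < ε → ∃ δ : ℝ≥0∞, 0 < δ ∧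
        ∀ h, sobolevENorm s (h - f) < r → sobolevENorm s (h - g) < δ →
          ∀ t ∈ Icc 0 T, sobolevENorm s (Φ h t - Φ g t) ≤ ε) ∧
      -- existence and uniqueness for Schwartz data, with `Φ` as the solution operator
      (∀ u₀ : 𝓢(ℝ, ℂ), sobolevENorm s ((u₀ : 𝓢'(ℝ, ℂ)) - f) < r →
        (∃ u, IsSmoothSolution T u₀ u) ∧
        ∀ u, IsSmoothSolution T u₀ u → ∀ t ∈ Icc 0 T,
          Lp.toTemperedDistribution (u t) = Φ u₀ t)

/-- The solution operator `u₀ ↦ u` of `i u_t + u_xx = u ū` on the time interval `[0,T]`, restricted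
to those Schwartz data with `‖u₀‖_{H^s} ≤ R` whose smooth solution exists up to time `T`, is
uniformly continuous from the `H^s` norm to the `C([0,T]; H^s)` norm. -/
def SolutionOperatorUniformlyContinuous (s T : ℝ) (R : ℝ≥0∞) : Prop :=
  ∀ ε : ℝ≥0∞, 0 < ε → ∃ δ : ℝ≥0∞, 0 < δ ∧
    ∀ (u₀ v₀ : 𝓢(ℝ, ℂ)) (u v : ℝ → Lp ℂ 2 (volume : Measure ℝ)),
      IsSmoothSolution T u₀ u → IsSmoothSolution T v₀ v →
      sobolevENorm s (u₀ : 𝓢'(ℝ, ℂ)) ≤ R → sobolevENorm s (v₀ : 𝓢'(ℝ, ℂ)) ≤ R →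
      sobolevENorm s ((u₀ : 𝓢'(ℝ, ℂ)) - (v₀ : 𝓢'(ℝ, ℂ))) < δ →
      ∀ t ∈ Icc 0 T,
        sobolevENorm s (Lp.toTemperedDistribution (u t) - Lp.toTemperedDistribution (v t)) ≤ ε

end

noncomputable section

open FourierTransform

/-! The product `u ū` moves two nearby high frequencies to a low one, where a norm with `s < 0`
weighs far more. Put `N = m⁴` and let the datum have as Fourier transform a bump of height `m³` and
width about `1/N` at frequency `N`. Its `H^s` norm is of order `m³ N^(-1/2) N^s = m^(1+4s)`, which
tends to `0` because `s < -1/4` (`eLpNorm_bumpData_le`). In the first Duhamel iterate at `ξ ∈ [0,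
1/N]` the phase is a time multiple of `ξ(ξ - η)` with `η` near `N`. It stays bounded, so for short
times nothing cancels, and the iterate is at least `t m²/2` there (`le_re_correlation_free`). On an
interval of length `m⁻⁴` this has `L²` norm of order `t`, whatever `m` is.

The true solution must exist up to the given `T` and stay close to this iterate. On the Fourier side
the nonlinearity is a correlation, and a positive weight `w` whose autocorrelation is at most `κ w`
makes Picard iteration converge in the sup norm relative to `w` as soon as `κ T ≤ 1/8`
(`exists_eq_duhamel`). `combWeight`, with peaks at all multiples of `N`, dominates the bump and has
`κ` of order `1/m` (`isCorrelationWeight_combWeight`). Hence every `T` is reached for large `m`, and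
the error `O(κ² T w) = O(m)` is negligible against `m²` (`le_norm_duhamel_solution`).

Thus data tending to `0` in `H^s` have solutions bounded away from `0` at a fixed time, while the
zero datum has the zero solution. This discontinuity at the origin refutes both properties. -/

/-- The correlation `ξ ↦ ∫ f(η) conj g(η - ξ) dη`, which is the Fourier transform of `F * conj G`
when `f` and `g` are the Fourier transforms of `F` and `G`. -/
def correlation (f g : ℝ → ℂ) (ξ : ℝ) : ℂ := ∫ η, f η * conj (g (η - ξ))

/-! ### Weights stable under correlation -/

/-- A continuous integrable weight `w` with `∫ w(η) w(η - ξ) dη ≤ κ w(ξ)`. -/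
structure IsCorrelationWeight (w : ℝ → ℝ) (κ : ℝ) : Prop where
  continuous : Continuous w
  pos : ∀ ξ, 0 < w ξ
  integrable : Integrable w
  bounded : ∃ C, ∀ ξ, w ξ ≤ C
  correlation_le : ∀ ξ, ∫ η, w η * w (η - ξ) ≤ κ * w ξ

namespace IsCorrelationWeight

variable {w : ℝ → ℝ} {κ : ℝ}

lemma integrable_mul_sub (hw : IsCorrelationWeight w κ) (ξ : ℝ) :
    Integrable fun η => w η * w (η - ξ) := by
  obtain ⟨C, hC⟩ := hw.bounded
  refine hw.integrable.mul_bdd (c := C) ?_ ?_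
  · exact (hw.continuous.comp (by fun_prop)).aestronglyMeasurable
  · exact ae_of_all _ fun η => by rw [Real.norm_of_nonneg (hw.pos _).le]; exact hC _

lemma const_nonneg (hw : IsCorrelationWeight w κ) : 0 ≤ κ := by
  have h := hw.correlation_le 0
  have h2 : 0 ≤ ∫ η, w η * w (η - 0) :=
    integral_nonneg fun η => mul_nonneg (hw.pos _).le (hw.pos _).le
  exact nonneg_of_mul_nonneg_left (h2.trans h) (hw.pos 0)

lemma integrable_of_le (hw : IsCorrelationWeight w κ) {f : ℝ → ℂ} (hf : Continuous f) {A : ℝ}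
    (hfw : ∀ ξ, ‖f ξ‖ ≤ A * w ξ) : Integrable f :=
  (hw.integrable.const_mul A).mono' hf.aestronglyMeasurable (ae_of_all _ hfw)

lemma norm_mul_conj_le {f g : ℝ → ℂ} {A B : ℝ}
    (hf : ∀ ξ, ‖f ξ‖ ≤ A * w ξ) (hg : ∀ ξ, ‖g ξ‖ ≤ B * w ξ) (η ξ : ℝ) :
    ‖f η * conj (g (η - ξ))‖ ≤ A * B * (w η * w (η - ξ)) := by
  rw [norm_mul, RCLike.norm_conj]
  calc _ ≤ (A * w η) * (B * w (η - ξ)) :=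
        mul_le_mul (hf _) (hg _) (norm_nonneg _) ((norm_nonneg _).trans (hf _))
    _ = _ := by ring

lemma integrable_mul_conj (hw : IsCorrelationWeight w κ) {f g : ℝ → ℂ} (hfc : Continuous f)
    (hgc : Continuous g) {A B : ℝ} (hf : ∀ ξ, ‖f ξ‖ ≤ A * w ξ) (hg : ∀ ξ, ‖g ξ‖ ≤ B * w ξ)
    (ξ : ℝ) : Integrable fun η => f η * conj (g (η - ξ)) :=
  ((hw.integrable_mul_sub ξ).const_mul (A * B)).mono'
    (by fun_prop : Continuous _).aestronglyMeasurable
    (ae_of_all _ fun η => norm_mul_conj_le hf hg η ξ)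

lemma norm_correlation_le (hw : IsCorrelationWeight w κ) {f g : ℝ → ℂ} {A B : ℝ}
    (hA : 0 ≤ A) (hB : 0 ≤ B)
    (hf : ∀ ξ, ‖f ξ‖ ≤ A * w ξ) (hg : ∀ ξ, ‖g ξ‖ ≤ B * w ξ) (ξ : ℝ) :
    ‖correlation f g ξ‖ ≤ A * B * κ * w ξ := by
  calc _ ≤ ∫ η, A * B * (w η * w (η - ξ)) :=
        norm_integral_le_of_norm_le ((hw.integrable_mul_sub ξ).const_mul _)
          (ae_of_all _ fun η => norm_mul_conj_le hf hg η ξ)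
    _ = A * B * ∫ η, w η * w (η - ξ) := integral_const_mul _ _
    _ ≤ A * B * (κ * w ξ) := by gcongr; exact hw.correlation_le ξ
    _ = _ := by ring

/-- Bilinear telescoping, `Q(f,f) - Q(g,g) = Q(f-g,f) + Q(g,f-g)`. It serves both the contraction
estimate and the comparison with the free evolution. -/
lemma norm_correlation_sub_le (hw : IsCorrelationWeight w κ) {f g : ℝ → ℂ} (hfc : Continuous f)
    (hgc : Continuous g) {A B D : ℝ} (hA : 0 ≤ A) (hB : 0 ≤ B) (hD : 0 ≤ D)
    (hf : ∀ ξ, ‖f ξ‖ ≤ A * w ξ) (hg : ∀ ξ, ‖g ξ‖ ≤ B * w ξ) (hfg : ∀ ξ, ‖f ξ - g ξ‖ ≤ D * w ξ)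
    (ξ : ℝ) :
    ‖correlation f f ξ - correlation g g ξ‖ ≤ (A + B) * D * κ * w ξ := by
  have hsplit : correlation f f ξ - correlation g g ξ
      = correlation (fun ξ => f ξ - g ξ) f ξ + correlation g (fun ξ => f ξ - g ξ) ξ := by
    have hdc : Continuous fun ξ => f ξ - g ξ := hfc.sub hgc
    unfold correlation
    rw [← integral_sub (hw.integrable_mul_conj hfc hfc hf hf ξ)
      (hw.integrable_mul_conj hgc hgc hg hg ξ),
      ← integral_add (hw.integrable_mul_conj hdc hfc hfg hf ξ)
      (hw.integrable_mul_conj hgc hdc hg hfg ξ)]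
    congr 1
    ext η
    simp only [map_sub]
    ring
  rw [hsplit]
  calc _ ≤ _ := norm_add_le _ _
    _ ≤ D * A * κ * w ξ + B * D * κ * w ξ :=
        add_le_add (hw.norm_correlation_le hD hA hfg hf ξ) (hw.norm_correlation_le hB hD hg hfg ξ)
    _ = _ := by ring

lemma continuous_correlation (hw : IsCorrelationWeight w κ) {X : Type*} [TopologicalSpace X]
    [FirstCountableTopology X] {f g : X → ℝ → ℂ} (hfc : Continuous f.uncurry)
    (hgc : Continuous g.uncurry) {A B : ℝ} (hA : 0 ≤ A) (hB : 0 ≤ B)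
    (hf : ∀ x ξ, ‖f x ξ‖ ≤ A * w ξ) (hg : ∀ x ξ, ‖g x ξ‖ ≤ B * w ξ) :
    Continuous fun p : X × ℝ => correlation (f p.1) (g p.1) p.2 := by
  obtain ⟨C, hC⟩ := hw.bounded
  unfold correlation
  refine continuous_of_dominated (bound := fun η => A * w η * (B * C)) ?_ ?_ ?_ ?_
  · intro p
    have h1 : Continuous (f p.1) := hfc.comp (by fun_prop : Continuous fun ξ => (p.1, ξ))
    have h2 : Continuous (g p.1) := hgc.comp (by fun_prop : Continuous fun ξ => (p.1, ξ))
    exact (by fun_prop : Continuous _).aestronglyMeasurable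
  · intro p
    refine ae_of_all _ fun η => ?_
    rw [norm_mul, RCLike.norm_conj]
    refine mul_le_mul (hf _ _) ((hg _ _).trans ?_) (norm_nonneg _)
      (mul_nonneg hA (hw.pos _).le)
    gcongr
    exact hC _
  · exact (hw.integrable.const_mul A).mul_const _
  · refine ae_of_all _ fun η => ?_
    have h1 : Continuous fun p : X × ℝ => f p.1 η :=
      hfc.comp (by fun_prop : Continuous fun p : X × ℝ => (p.1, η))
    have h2 : Continuous fun p : X × ℝ => g p.1 (η - p.2) :=
      hgc.comp (by fun_prop : Continuous fun p : X × ℝ => (p.1, η - p.2))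
    fun_prop

end IsCorrelationWeight

/-! ### Duhamel's formula on the Fourier side and Picard iteration -/

/-- The symbol `4π²ξ²` of `-∂ₓ²`. -/
def schrodingerSymbol (ξ : ℝ) : ℝ := 4 * Real.pi ^ 2 * ξ ^ 2

@[fun_prop]
lemma continuous_schrodingerSymbol : Continuous schrodingerSymbol := by
  unfold schrodingerSymbol; fun_prop

/-- The free propagator `e^{-itθ(ξ)}` on the Fourier side. -/
def propagator (t ξ : ℝ) : ℂ := Complex.exp (-(t * schrodingerSymbol ξ : ℝ) * Complex.I)

@[simp]
lemma norm_propagator (t ξ : ℝ) : ‖propagator t ξ‖ = 1 := by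
  rw [propagator, ← Complex.ofReal_neg, Complex.norm_exp_ofReal_mul_I]

@[fun_prop]
lemma continuous_propagator {X : Type*} [TopologicalSpace X] {f g : X → ℝ} (hf : Continuous f)
    (hg : Continuous g) : Continuous fun x => propagator (f x) (g x) := by
  unfold propagator; fun_prop

@[simp]
lemma propagator_zero (ξ : ℝ) : propagator 0 ξ = 1 := by simp [propagator]

/-- The right hand side of Duhamel's formula on the Fourier side, for initial value `a₀` and
the nonlinearity evaluated at `a`. -/
def duhamel (a₀ : ℝ → ℂ) (a : ℝ → ℝ → ℂ) (t ξ : ℝ) : ℂ :=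
  propagator t ξ *
    (a₀ ξ - Complex.I * ∫ s in (0 : ℝ)..t, propagator (-s) ξ * correlation (a s) (a s) ξ)

namespace IsCorrelationWeight

variable {w : ℝ → ℝ} {κ : ℝ}

lemma continuous_duhamel_integrand (hw : IsCorrelationWeight w κ)
    {a : ℝ → ℝ → ℂ} (ha : Continuous a.uncurry) {A : ℝ}
    (hA : 0 ≤ A) (haw : ∀ t ξ, ‖a t ξ‖ ≤ A * w ξ) :
    Continuous fun p : ℝ × ℝ => propagator (-p.1) p.2 * correlation (a p.1) (a p.1) p.2 := by
  have := hw.continuous_correlation ha ha hA hA haw haw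
  fun_prop

lemma continuous_duhamel (hw : IsCorrelationWeight w κ) {a₀ : ℝ → ℂ} (ha₀ : Continuous a₀)
    {a : ℝ → ℝ → ℂ} (ha : Continuous a.uncurry) {A : ℝ}
    (hA : 0 ≤ A) (haw : ∀ t ξ, ‖a t ξ‖ ≤ A * w ξ) :
    Continuous (duhamel a₀ a).uncurry := by
  have h := hw.continuous_duhamel_integrand ha hA haw
  have h1 : Continuous fun p : ℝ × ℝ =>
      ∫ s in (0 : ℝ)..p.1, propagator (-s) p.2 * correlation (a s) (a s) p.2 :=
    intervalIntegral.continuous_parametric_intervalIntegral_of_continuous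
      (f := fun (p : ℝ × ℝ) (s : ℝ) => propagator (-s) p.2 * correlation (a s) (a s) p.2)
      (h.comp (by fun_prop : Continuous fun q : (ℝ × ℝ) × ℝ => (q.2, q.1.2))) continuous_fst
  change Continuous fun p : ℝ × ℝ => propagator p.1 p.2 * (a₀ p.2 - Complex.I *
    ∫ s in (0 : ℝ)..p.1, propagator (-s) p.2 * correlation (a s) (a s) p.2)
  fun_prop

lemma norm_duhamel_integral_le (hw : IsCorrelationWeight w κ) {a : ℝ → ℝ → ℂ} {A : ℝ}
    (hA : 0 ≤ A) (haw : ∀ t ξ, ‖a t ξ‖ ≤ A * w ξ) (t ξ : ℝ) :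
    ‖∫ s in (0 : ℝ)..t, propagator (-s) ξ * correlation (a s) (a s) ξ‖
      ≤ A * A * κ * w ξ * |t| := by
  simpa using intervalIntegral.norm_integral_le_of_norm_le_const (a := (0 : ℝ)) (b := t)
    (f := fun s => propagator (-s) ξ * correlation (a s) (a s) ξ) (C := A * A * κ * w ξ)
    fun s _ => by
      rw [norm_mul, norm_propagator, one_mul]
      exact hw.norm_correlation_le hA hA (haw s) (haw s) ξ

lemma norm_duhamel_sub_le (hw : IsCorrelationWeight w κ) {a₀ : ℝ → ℂ} {a : ℝ → ℝ → ℂ} {A : ℝ}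
    (hA : 0 ≤ A) (haw : ∀ t ξ, ‖a t ξ‖ ≤ A * w ξ) (t ξ : ℝ) :
    ‖duhamel a₀ a t ξ - propagator t ξ * a₀ ξ‖ ≤ A * A * κ * |t| * w ξ := by
  have : duhamel a₀ a t ξ - propagator t ξ * a₀ ξ = propagator t ξ * -(Complex.I *
      ∫ s in (0 : ℝ)..t, propagator (-s) ξ * correlation (a s) (a s) ξ) := by
    unfold duhamel; ring
  rw [this, norm_mul, norm_propagator, one_mul, norm_neg, norm_mul, Complex.norm_I, one_mul]
  refine (hw.norm_duhamel_integral_le hA haw t ξ).trans_eq (by ring)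

lemma norm_duhamel_le (hw : IsCorrelationWeight w κ) {a₀ : ℝ → ℂ} (ha₀ : ∀ ξ, ‖a₀ ξ‖ ≤ w ξ)
    {a : ℝ → ℝ → ℂ} {A : ℝ} (hA : 0 ≤ A) (haw : ∀ t ξ, ‖a t ξ‖ ≤ A * w ξ) (t ξ : ℝ) :
    ‖duhamel a₀ a t ξ‖ ≤ (1 + A * A * κ * |t|) * w ξ := by
  have h := norm_add_le (propagator t ξ * a₀ ξ) (duhamel a₀ a t ξ - propagator t ξ * a₀ ξ)
  rw [add_sub_cancel, norm_mul, norm_propagator, one_mul] at h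
  linarith [ha₀ ξ, hw.norm_duhamel_sub_le (a₀ := a₀) hA haw t ξ]

lemma norm_duhamel_sub_duhamel_le (hw : IsCorrelationWeight w κ) (a₀ : ℝ → ℂ)
    {a b : ℝ → ℝ → ℂ} (ha : Continuous a.uncurry) (hb : Continuous b.uncurry) {A D : ℝ}
    (hA : 0 ≤ A) (hD : 0 ≤ D) (haw : ∀ t ξ, ‖a t ξ‖ ≤ A * w ξ) (hbw : ∀ t ξ, ‖b t ξ‖ ≤ A * w ξ)
    (hab : ∀ t ξ, ‖a t ξ - b t ξ‖ ≤ D * w ξ) (t ξ : ℝ) :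
    ‖duhamel a₀ a t ξ - duhamel a₀ b t ξ‖ ≤ 2 * A * D * κ * |t| * w ξ := by
  have hca : Continuous fun s => propagator (-s) ξ * correlation (a s) (a s) ξ :=
    (hw.continuous_duhamel_integrand ha hA haw).comp (by fun_prop : Continuous fun s => (s, ξ))
  have hcb : Continuous fun s => propagator (-s) ξ * correlation (b s) (b s) ξ :=
    (hw.continuous_duhamel_integrand hb hA hbw).comp (by fun_prop : Continuous fun s => (s, ξ))
  have h1 : duhamel a₀ a t ξ - duhamel a₀ b t ξ = propagator t ξ * -(Complex.I *
      ∫ s in (0 : ℝ)..t, (propagator (-s) ξ * correlation (a s) (a s) ξ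
        - propagator (-s) ξ * correlation (b s) (b s) ξ)) := by
    rw [intervalIntegral.integral_sub (hca.intervalIntegrable _ _) (hcb.intervalIntegrable _ _)]
    unfold duhamel; ring
  rw [h1, norm_mul, norm_propagator, one_mul, norm_neg, norm_mul, Complex.norm_I, one_mul]
  have h2 := intervalIntegral.norm_integral_le_of_norm_le_const (a := (0 : ℝ)) (b := t)
    (f := fun s => propagator (-s) ξ * correlation (a s) (a s) ξ
        - propagator (-s) ξ * correlation (b s) (b s) ξ) (C := (A + A) * D * κ * w ξ)
    fun s _ => by
      rw [← mul_sub, norm_mul, norm_propagator, one_mul]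
      exact hw.norm_correlation_sub_le (ha.comp (by fun_prop : Continuous fun ξ => (s, ξ)))
        (hb.comp (by fun_prop : Continuous fun ξ => (s, ξ))) hA hA hD (haw s) (hbw s) (hab s) ξ
  refine h2.trans_eq ?_
  rw [sub_zero]; ring

/-- Local existence by Picard iteration in the space of functions bounded by a multiple
of the weight. -/
theorem exists_eq_duhamel (hw : IsCorrelationWeight w κ) {a₀ : ℝ → ℂ} (ha₀c : Continuous a₀)
    (ha₀ : ∀ ξ, ‖a₀ ξ‖ ≤ w ξ) {T : ℝ} (hT : 0 ≤ T) (hκT : κ * T ≤ 1 / 8) :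
    ∃ a : ℝ → ℝ → ℂ, Continuous a.uncurry ∧ (∀ t ξ, ‖a t ξ‖ ≤ 2 * w ξ) ∧
      ∀ t ∈ Icc 0 T, ∀ ξ, a t ξ = duhamel a₀ a t ξ := by
  let E := BoundedContinuousFunction (ℝ × ℝ) ℂ
  -- Freezing time outside `[0,T]` lets the iteration run on functions of all `t ∈ ℝ`, with bounds
  -- uniform in time.
  let clamp : ℝ → ℝ := fun t => max 0 (min t T)
  have hclamp : Continuous clamp := by fun_prop
  have hclamp0 : ∀ t, |clamp t| ≤ T := fun t => by
    rw [abs_of_nonneg (le_max_left _ _)]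
    exact max_le hT (min_le_right _ _)
  have hκ := hw.const_nonneg
  have hw0 : ∀ ξ, w ξ ≠ 0 := fun ξ => (hw.pos ξ).ne'
  -- Factoring out the weight turns the weighted sup norm into the norm of bounded continuous
  -- functions.
  let W : E → ℝ → ℝ → ℂ := fun b t ξ => w ξ * b (t, ξ)
  have hWc : ∀ b : E, Continuous (W b).uncurry := fun b => by
    have := hw.continuous
    change Continuous fun p : ℝ × ℝ => (w p.2 : ℂ) * b (p.1, p.2)
    fun_prop
  have hWn : ∀ (b : E) (t ξ), ‖W b t ξ‖ ≤ ‖b‖ * w ξ := fun b t ξ => by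
    simp only [W, norm_mul, Complex.norm_real, Real.norm_of_nonneg (hw.pos ξ).le]
    rw [mul_comm]
    exact mul_le_mul_of_nonneg_right (b.norm_coe_le_norm _) (hw.pos ξ).le
  have hWd : ∀ (b c : E) (t ξ), ‖W b t ξ - W c t ξ‖ ≤ ‖b - c‖ * w ξ := fun b c t ξ => by
    have : W b t ξ - W c t ξ = W (b - c) t ξ := (mul_sub _ _ _).symm
    rw [this]; exact hWn _ _ _
  have hΓc : ∀ b : E, Continuous fun p : ℝ × ℝ =>
      duhamel a₀ (W b) (clamp p.1) p.2 / (w p.2 : ℂ) := fun b => by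
    have h1 := hw.continuous_duhamel ha₀c (hWc b) (norm_nonneg b) (hWn b)
    have h2 : Continuous fun p : ℝ × ℝ => duhamel a₀ (W b) (clamp p.1) p.2 :=
      h1.comp (by fun_prop : Continuous fun p : ℝ × ℝ => (clamp p.1, p.2))
    have := hw.continuous
    exact h2.div (by fun_prop) fun p => Complex.ofReal_ne_zero.2 (hw0 _)
  have hΓn : ∀ (b : E) (p : ℝ × ℝ), ‖duhamel a₀ (W b) (clamp p.1) p.2 / (w p.2 : ℂ)‖
      ≤ 1 + ‖b‖ * ‖b‖ * (κ * T) := fun b p => by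
    rw [norm_div, Complex.norm_real, Real.norm_of_nonneg (hw.pos _).le, div_le_iff₀ (hw.pos _)]
    refine (hw.norm_duhamel_le ha₀ (norm_nonneg b) (hWn b) _ _).trans ?_
    refine mul_le_mul_of_nonneg_right ?_ (hw.pos _).le
    rw [mul_assoc (‖b‖ * ‖b‖)]
    gcongr
    exact hclamp0 _
  let Γ : E → E := fun b => BoundedContinuousFunction.ofNormedAddCommGroup _ (hΓc b) _ (hΓn b)
  have hΓa : ∀ b p, Γ b p = duhamel a₀ (W b) (clamp p.1) p.2 / (w p.2 : ℂ) := fun b p => rfl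
  -- With radius 2 and `κ T ≤ 1/8` the map has norm at most `1 + 4/8 ≤ 2` and Lipschitz constant `2
  -- · 2 · 1/8 = 1/2`.
  let S : Set E := Metric.closedBall 0 2
  have hSn : ∀ b ∈ S, ‖b‖ ≤ 2 := fun b hb => by simpa [S] using hb
  have hmaps : MapsTo Γ S S := fun b hb => by
    have hb := hSn b hb
    have : ‖Γ b‖ ≤ 2 := by
      refine (BoundedContinuousFunction.norm_le (by norm_num)).2 fun p => ?_
      rw [hΓa]
      refine (hΓn b p).trans ?_
      have : ‖b‖ * ‖b‖ ≤ 4 := by nlinarith [norm_nonneg b]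
      nlinarith [mul_nonneg hκ hT]
    simpa [S] using this
  have hcontr : ContractingWith (1 / 2) (hmaps.restrict Γ S S) := by
    refine ⟨by norm_num, LipschitzWith.of_dist_le_mul fun b c => ?_⟩
    have hb := hSn b b.2
    have hc := hSn c c.2
    rw [Subtype.dist_eq, Subtype.dist_eq, dist_eq_norm, dist_eq_norm]
    simp only [MapsTo.val_restrict_apply]
    refine (BoundedContinuousFunction.norm_le (by positivity)).2 fun p => ?_
    rw [BoundedContinuousFunction.coe_sub, Pi.sub_apply, hΓa, hΓa, ← sub_div, norm_div,
      Complex.norm_real, Real.norm_of_nonneg (hw.pos _).le, div_le_iff₀ (hw.pos _)]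
    have hbW : ∀ t ξ, ‖W b t ξ‖ ≤ 2 * w ξ := fun t ξ =>
      (hWn _ _ _).trans (mul_le_mul_of_nonneg_right hb (hw.pos _).le)
    have hcW : ∀ t ξ, ‖W c t ξ‖ ≤ 2 * w ξ := fun t ξ =>
      (hWn _ _ _).trans (mul_le_mul_of_nonneg_right hc (hw.pos _).le)
    refine (hw.norm_duhamel_sub_duhamel_le a₀ (hWc b) (hWc c) (by norm_num) (norm_nonneg _)
      hbW hcW (hWd b c) _ _).trans ?_
    refine mul_le_mul_of_nonneg_right ?_ (hw.pos _).le
    have h1 : κ * |clamp p.1| ≤ 1 / 8 :=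
      (mul_le_mul_of_nonneg_left (hclamp0 _) hκ).trans hκT
    have h2 := norm_nonneg ((b : E) - c)
    push_cast
    nlinarith
  obtain ⟨b, hbS, hbfix, -⟩ := hcontr.exists_fixedPoint' (x := 0)
    (Metric.isClosed_closedBall.isComplete) hmaps (by simp [S]) (edist_ne_top _ _)
  refine ⟨W b, hWc b, fun t ξ => (hWn _ _ _).trans
    (mul_le_mul_of_nonneg_right (hSn b hbS) (hw.pos _).le), fun t ht ξ => ?_⟩
  have h1 : b (t, ξ) = duhamel a₀ (W b) (clamp t) ξ / (w ξ : ℂ) := by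
    conv_lhs => rw [← hbfix.eq]
    exact hΓa b (t, ξ)
  have h2 : clamp t = t := by
    simp only [clamp]; rw [min_eq_left ht.2, max_eq_right ht.1]
  rw [h2] at h1
  change (w ξ : ℂ) * b (t, ξ) = _
  rw [h1, mul_div_cancel₀ _ (Complex.ofReal_ne_zero.2 (hw0 _))]

end IsCorrelationWeight

/-! ### Sobolev norms through the Fourier transform -/

section Sobolev

lemma toTemperedDistribution_sub (f g : Lp ℂ 2 (volume : Measure ℝ)) :
    Lp.toTemperedDistribution (f - g)
      = Lp.toTemperedDistribution f - Lp.toTemperedDistribution g :=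
  map_sub (Lp.toTemperedDistributionCLM ℂ (volume : Measure ℝ) 2) f g

lemma toTemperedDistribution_injective :
    Function.Injective (Lp.toTemperedDistribution (μ := (volume : Measure ℝ)) (F := ℂ) (p := 2)) :=
  LinearMap.ker_eq_bot.1
    (Lp.ker_toTemperedDistributionCLM_eq_bot (μ := (volume : Measure ℝ)) (F := ℂ) (p := 2))

lemma besselPotential_fourierInv (s : ℝ) {f g : Lp ℂ 2 (volume : Measure ℝ)}
    (h : ∀ᵐ ξ, g ξ = ((1 + ξ ^ 2) ^ (s / 2) : ℝ) * f ξ) :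
    besselPotential ℝ ℂ s (Lp.toTemperedDistribution (𝓕⁻ f))
      = Lp.toTemperedDistribution (𝓕⁻ g) := by
  rw [besselPotential, fourierMultiplierCLM_apply, Lp.fourier_toTemperedDistribution_eq,
    fourier_fourierInv_eq, ← Lp.fourierInv_toTemperedDistribution_eq]
  congr 1
  ext φ
  rw [smulLeftCLM_apply_apply, Lp.toTemperedDistribution_apply, Lp.toTemperedDistribution_apply]
  refine integral_congr_ae ?_
  filter_upwards [h] with ξ hξ
  rw [hξ, SchwartzMap.smulLeftCLM_apply_apply (by fun_prop)]
  simp only [smul_eq_mul, Real.norm_eq_abs, sq_abs]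
  ring

/-- An `L²` function is determined by its tempered distribution, so the infimum runs over a single
function. -/
lemma sobolevENorm_eq_enorm {s : ℝ} {f : 𝓢'(ℝ, ℂ)} {g : Lp ℂ 2 (volume : Measure ℝ)}
    (h : besselPotential ℝ ℂ s f = Lp.toTemperedDistribution g) : sobolevENorm s f = ‖g‖ₑ := by
  refine le_antisymm (iInf₂_le g h) (le_iInf₂ fun g' hg' => ?_)
  rw [toTemperedDistribution_injective (h.symm.trans hg')]

/-- The tempered distribution with Fourier transform `f ∈ L²`, as an `L²` function. -/
abbrev ofFourier {f : ℝ → ℂ} (hf : MemLp f 2) : Lp ℂ 2 (volume : Measure ℝ) := 𝓕⁻ (hf.toLp f)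

lemma besselPotential_ofFourier {s : ℝ} {f : ℝ → ℂ} (hf : MemLp f 2)
    (hfs : MemLp (fun ξ => (((1 + ξ ^ 2) ^ (s / 2) : ℝ) : ℂ) * f ξ) 2) :
    besselPotential ℝ ℂ s (Lp.toTemperedDistribution (ofFourier hf))
      = Lp.toTemperedDistribution (ofFourier hfs) := by
  refine besselPotential_fourierInv s ?_
  filter_upwards [hf.coeFn_toLp, hfs.coeFn_toLp] with ξ h1 h2
  rw [h1, h2]

lemma sobolevENorm_ofFourier {s : ℝ} {f : ℝ → ℂ} (hf : MemLp f 2)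
    (hfs : MemLp (fun ξ => (((1 + ξ ^ 2) ^ (s / 2) : ℝ) : ℂ) * f ξ) 2) :
    sobolevENorm s (Lp.toTemperedDistribution (ofFourier hf))
      = eLpNorm (fun ξ => (((1 + ξ ^ 2) ^ (s / 2) : ℝ) : ℂ) * f ξ) 2 := by
  rw [sobolevENorm_eq_enorm (besselPotential_ofFourier hf hfs)]
  have : ‖ofFourier hfs‖ = ‖hfs.toLp _‖ := (Lp.fourierTransformₗᵢ ℝ ℂ).symm.norm_map _
  rw [← ofReal_norm, this, ofReal_norm, Lp.enorm_toLp]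

lemma ofFourier_sub {f g : ℝ → ℂ} (hf : MemLp f 2) (hg : MemLp g 2) :
    ofFourier (hf.sub hg) = ofFourier hf - ofFourier hg := by
  unfold ofFourier
  rw [MemLp.toLp_sub]
  exact map_sub (Lp.fourierTransformₗᵢ ℝ ℂ).symm _ _

end Sobolev

/-! ### Transferring the tested equation to the Fourier side -/

section Fourier

lemma integral_fourierInv_mul_eq {f g : ℝ → ℂ} (hf : Integrable f) (hg : Integrable g) :
    ∫ x, 𝓕⁻ f x * g x = ∫ ξ, f ξ * 𝓕⁻ g ξ := by
  have h := VectorFourier.integral_fourierIntegral_smul_eq_flip (L := innerₗ ℝ)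
    Real.continuous_fourierChar continuous_inner hf (hg.comp_neg)
  simp only [smul_eq_mul] at h
  have h1 : ∀ x, 𝓕⁻ f x = 𝓕 f (-x) := fun x => Real.fourierInv_eq_fourier_neg f x
  calc ∫ x, 𝓕⁻ f x * g x = ∫ x, 𝓕 f x * g (-x) := by
        rw [← integral_neg_eq_self]
        simp [h1]
    _ = ∫ ξ, f ξ * 𝓕 (fun x => g (-x)) ξ := by
        simpa using! h
    _ = _ := by rw [← Real.fourierInv_eq_fourier_comp_neg]

lemma integral_ofFourier_mul {f : ℝ → ℂ} (hf : MemLp f 2) (φ : 𝓢(ℝ, ℂ)) :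
    ∫ x, ofFourier hf x * φ x = ∫ ξ, f ξ * 𝓕⁻ (φ : ℝ → ℂ) ξ := by
  have h1 : Lp.toTemperedDistribution (ofFourier hf) φ = ∫ x, ofFourier hf x * φ x := by
    rw [Lp.toTemperedDistribution_apply]
    simp only [smul_eq_mul, mul_comm]
  rw [← h1, ← Lp.fourierInv_toTemperedDistribution_eq, TemperedDistribution.fourierInv_apply,
    Lp.toTemperedDistribution_apply, ← SchwartzMap.fourierInv_coe]
  refine integral_congr_ae ?_
  filter_upwards [hf.coeFn_toLp] with ξ h
  rw [h, smul_eq_mul, mul_comm]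

lemma continuous_fourierInv {f : ℝ → ℂ} (hf : Integrable f) : Continuous (𝓕⁻ f) := by
  have h : 𝓕⁻ f = fun x => 𝓕 f (-x) := funext (Real.fourierInv_eq_fourier_neg f)
  have h2 : Continuous (𝓕 f) := VectorFourier.fourierIntegral_continuous
    Real.continuous_fourierChar (by exact continuous_inner) hf
  rw [h]
  exact h2.comp continuous_neg

/-- The nonlinearity is pointwise in `x`, so the abstract `L²` inverse transform has to be
identified with the integral. Both have the same pairing with smooth compactly supported functions.
-/
lemma ofFourier_ae_eq {f : ℝ → ℂ} (hf : MemLp f 2) (hf1 : Integrable f) :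
    ofFourier hf =ᵐ[volume] 𝓕⁻ f := by
  refine ae_eq_of_integral_contDiff_smul_eq ((Lp.memLp _).locallyIntegrable one_le_two)
    (continuous_fourierInv hf1).locallyIntegrable fun g hg hgc => ?_
  have hg₁ : HasCompactSupport (Complex.ofRealCLM ∘ g) := hgc.comp_left rfl
  have hg₂ : ContDiff ℝ (⊤ : ℕ∞) (Complex.ofRealCLM ∘ g) := by fun_prop
  have h1 := integral_ofFourier_mul hf (hg₁.toSchwartzMap hg₂)
  have h2 := integral_fourierInv_mul_eq hf1 (hg₁.toSchwartzMap hg₂).integrable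
  rw [← h2] at h1
  simpa [mul_comm] using h1

/-- The convolution theorem for `f` and `η ↦ conj (f (-η))`, whose convolution is the correlation.
-/
lemma fourierInv_mul_conj {f : ℝ → ℂ} (hf : Integrable f) (x : ℝ) :
    𝓕⁻ f x * conj (𝓕⁻ f x) = 𝓕⁻ (correlation f f) x := by
  have hg : Integrable fun η => conj (f (-η)) :=
    (Complex.conjCLE.toContinuousLinearMap.integrable_comp hf).comp_neg
  have h1 := Real.fourier_mul_convolution_eq hf hg (-x)
  have h2 : MeasureTheory.convolution f (fun η => conj (f (-η))) (ContinuousLinearMap.mul ℂ ℂ)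
      volume = correlation f f := by
    ext ξ
    simp [MeasureTheory.convolution, correlation]
  have h3 : 𝓕 (fun η => conj (f (-η))) (-x) = conj (𝓕⁻ f x) := by
    rw [Real.fourierInv_eq', Real.fourier_eq', ← integral_conj, ← integral_neg_eq_self]
    congr 1
    ext η
    simp [← Complex.exp_conj, map_ofNat]
  rw [Real.fourierInv_eq_fourier_neg (correlation f f), ← h2, h1, h3,
    ← Real.fourierInv_eq_fourier_neg]

lemma fourierInv_iteratedDeriv_two (φ : 𝓢(ℝ, ℂ)) (ξ : ℝ) :
    𝓕⁻ (iteratedDeriv 2 φ) ξ = -(schrodingerSymbol ξ : ℂ) * 𝓕⁻ (φ : ℝ → ℂ) ξ := by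
  have hint : ∀ n : ℕ, (n : ℕ∞) ≤ 2 → Integrable (iteratedDeriv n φ) := fun n _ => by
    have h := φ.integrable_pow_mul_iteratedFDeriv volume 0 n
    simp only [pow_zero, one_mul, norm_iteratedFDeriv_eq_norm_iteratedDeriv] at h
    refine (integrable_norm_iff ?_).1 h
    exact ((φ.smooth ⊤).continuous_iteratedDeriv n (by exact_mod_cast le_top)).aestronglyMeasurable
  rw [Real.fourierInv_eq_fourier_neg, Real.fourierInv_eq_fourier_neg,
    Real.fourier_iteratedDeriv (N := 2) (φ.smooth _) hint le_rfl]
  simp only [schrodingerSymbol, smul_eq_mul]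
  push_cast
  linear_combination (4 * (Real.pi : ℂ) ^ 2 * ξ ^ 2 * 𝓕 (φ : ℝ → ℂ) (-ξ)) * Complex.I_sq

end Fourier

/-! ### Rapidly decaying weights and regularity in every Sobolev space -/

lemma memLp_two_inv_one_add_sq : MemLp (fun ξ : ℝ => (1 + ξ ^ 2)⁻¹) 2 := by
  have hc : Continuous fun ξ : ℝ => (1 + ξ ^ 2)⁻¹ :=
    Continuous.inv₀ (by fun_prop) fun ξ => by positivity
  rw [memLp_two_iff_integrable_sq hc.aestronglyMeasurable]
  refine integrable_inv_one_add_sq.mono' (by fun_prop) (ae_of_all _ fun ξ => ?_)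
  have h0 : 0 ≤ (1 + ξ ^ 2)⁻¹ := by positivity
  have h1 : (1 + ξ ^ 2)⁻¹ ≤ 1 := inv_le_one_of_one_le₀ (by nlinarith [sq_nonneg ξ])
  rw [Real.norm_of_nonneg (by positivity)]
  nlinarith

/-- A weight which decays faster than any power. -/
def IsRapidlyDecaying (w : ℝ → ℝ) : Prop := ∀ k : ℕ, ∃ C, ∀ ξ, (1 + ξ ^ 2) ^ k * w ξ ≤ C

namespace IsRapidlyDecaying

variable {w : ℝ → ℝ}

/-- The decay of `w` absorbs the Bessel factor with `1 + ξ²` to spare, leaving a fixed `L²`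
majorant. The constant depends only on `w` and `σ`. -/
lemma exists_norm_le (hw : IsRapidlyDecaying w) (hpos : ∀ ξ, 0 < w ξ) (σ : ℝ) :
    ∃ C, 0 ≤ C ∧ ∀ (A : ℝ) (z : ℂ) (ξ : ℝ), ‖z‖ ≤ A * w ξ →
      ‖(((1 + ξ ^ 2) ^ (σ / 2) : ℝ) : ℂ) * z‖ ≤ A * C * (1 + ξ ^ 2)⁻¹ := by
  obtain ⟨k, hk⟩ := exists_nat_ge (σ / 2)
  obtain ⟨C, hC⟩ := hw (k + 1)
  refine ⟨C, ?_, fun A z ξ hz => ?_⟩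
  · exact le_trans (mul_nonneg (by positivity) (hpos 0).le) (hC 0)
  have h1 : (1 : ℝ) ≤ 1 + ξ ^ 2 := by nlinarith [sq_nonneg ξ]
  have h0 : (0 : ℝ) < 1 + ξ ^ 2 := by positivity
  have hA : 0 ≤ A := nonneg_of_mul_nonneg_left ((norm_nonneg z).trans hz) (hpos ξ)
  have h2 : (1 + ξ ^ 2) ^ (σ / 2) ≤ (1 + ξ ^ 2) ^ k := by
    rw [← Real.rpow_natCast (1 + ξ ^ 2) k]
    exact Real.rpow_le_rpow_of_exponent_le h1 hk
  rw [norm_mul, Complex.norm_real, Real.norm_of_nonneg (by positivity)]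
  rw [← div_eq_mul_inv, le_div_iff₀ h0]
  calc (1 + ξ ^ 2) ^ (σ / 2) * ‖z‖ * (1 + ξ ^ 2)
      ≤ (1 + ξ ^ 2) ^ k * (A * w ξ) * (1 + ξ ^ 2) := by gcongr
    _ = A * ((1 + ξ ^ 2) ^ (k + 1) * w ξ) := by ring
    _ ≤ A * C := by gcongr; exact hC ξ

lemma memLp_weighted (hw : IsRapidlyDecaying w) (hpos : ∀ ξ, 0 < w ξ) (σ : ℝ) {f : ℝ → ℂ}
    (hf : Continuous f) {A : ℝ} (hA : ∀ ξ, ‖f ξ‖ ≤ A * w ξ) :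
    MemLp (fun ξ => (((1 + ξ ^ 2) ^ (σ / 2) : ℝ) : ℂ) * f ξ) 2 := by
  obtain ⟨C, -, hC⟩ := hw.exists_norm_le hpos σ
  have hc : Continuous fun ξ : ℝ => (((1 + ξ ^ 2) ^ (σ / 2) : ℝ) : ℂ) * f ξ := by
    have : Continuous fun ξ : ℝ => (1 + ξ ^ 2) ^ (σ / 2) :=
      Continuous.rpow_const (by fun_prop) fun ξ => Or.inl (by positivity)
    fun_prop
  exact (memLp_two_inv_one_add_sq.const_mul (A * C)).mono' hc.aestronglyMeasurable
    (ae_of_all _ fun ξ => hC A (f ξ) ξ (hA ξ))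

lemma memLp (hw : IsRapidlyDecaying w) (hpos : ∀ ξ, 0 < w ξ) {f : ℝ → ℂ}
    (hf : Continuous f) {A : ℝ} (hA : ∀ ξ, ‖f ξ‖ ≤ A * w ξ) : MemLp f 2 := by
  simpa using hw.memLp_weighted hpos 0 hf hA

lemma integrable_sq_mul (hw : IsRapidlyDecaying w) (hpos : ∀ ξ, 0 < w ξ) (hwc : Continuous w) :
    Integrable fun ξ => (1 + ξ ^ 2) * w ξ := by
  obtain ⟨C, hC⟩ := hw 2
  refine (integrable_inv_one_add_sq.const_mul C).mono' (by fun_prop) (ae_of_all _ fun ξ => ?_)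
  have h0 : (0 : ℝ) < 1 + ξ ^ 2 := by positivity
  rw [Real.norm_of_nonneg (mul_nonneg h0.le (hpos ξ).le), ← div_eq_mul_inv, le_div_iff₀ h0]
  refine le_trans (le_of_eq ?_) (hC ξ)
  ring

/-- A jointly continuous family dominated by the weight is the Fourier transform of a curve in
`C([0,T]; H^σ)`. -/
lemma continuousInSobolev_ofFourier (hw : IsRapidlyDecaying w) (hpos : ∀ ξ, 0 < w ξ)
    {a : ℝ → ℝ → ℂ} (ha : Continuous a.uncurry) {A : ℝ} (hA : ∀ t ξ, ‖a t ξ‖ ≤ A * w ξ)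
    (hmem : ∀ t, MemLp (a t) 2) (σ T : ℝ) :
    ContinuousInSobolev σ T fun t => Lp.toTemperedDistribution (ofFourier (hmem t)) := by
  have hac : ∀ t, Continuous (a t) := fun t =>
    ha.comp (by fun_prop : Continuous fun ξ : ℝ => (t, ξ))
  intro t _
  refine ⟨⟨_, besselPotential_ofFourier (hmem t) (hw.memLp_weighted hpos σ (hac t) (hA t))⟩, ?_⟩
  have hsub : ∀ τ ξ, ‖(a τ - a t) ξ‖ ≤ (2 * A) * w ξ := fun τ ξ => by
    have h := norm_sub_le (a τ ξ) (a t ξ)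
    rw [Pi.sub_apply]
    linarith [hA τ ξ, hA t ξ]
  have hnorm : ∀ τ, sobolevENorm σ (Lp.toTemperedDistribution (ofFourier (hmem τ))
      - Lp.toTemperedDistribution (ofFourier (hmem t)))
      = (∫⁻ ξ, ‖(((1 + ξ ^ 2) ^ (σ / 2) : ℝ) : ℂ) * (a τ - a t) ξ‖ₑ ^ (2 : ℝ)) ^ (1 / (2 : ℝ)) := by
    intro τ
    rw [← toTemperedDistribution_sub, ← ofFourier_sub, sobolevENorm_ofFourier _
      (hw.memLp_weighted hpos σ ((hac τ).sub (hac t)) (hsub τ)),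
      eLpNorm_eq_lintegral_rpow_enorm_toReal (by norm_num) (by norm_num)]
    simp
  simp_rw [hnorm]
  refine Tendsto.mono_left ?_ nhdsWithin_le_nhds
  have hcw : Continuous fun ξ : ℝ => (1 + ξ ^ 2) ^ (σ / 2) :=
    Continuous.rpow_const (by fun_prop) fun ξ => Or.inl (by positivity)
  obtain ⟨C, hC0, hC⟩ := hw.exists_norm_le hpos σ
  have hlim : Tendsto (fun τ => ∫⁻ ξ, ‖(((1 + ξ ^ 2) ^ (σ / 2) : ℝ) : ℂ) * (a τ - a t) ξ‖ₑ ^ (2 : ℝ))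
      (𝓝 t) (𝓝 (∫⁻ _ : ℝ, 0)) := by
    refine tendsto_lintegral_filter_of_dominated_convergence
      (fun ξ => ‖(2 * A) * C * (1 + ξ ^ 2)⁻¹‖ₑ ^ (2 : ℝ)) ?_ ?_ ?_ ?_
    · refine Eventually.of_forall fun τ => ?_
      have h1 := hac τ
      have h2 := hac t
      refine (Measurable.enorm ?_).pow_const _
      simp only [Pi.sub_apply]
      exact (by fun_prop : Continuous _).measurable
    · refine Eventually.of_forall fun τ => ae_of_all _ fun ξ => ?_
      refine ENNReal.rpow_le_rpow ?_ (by norm_num)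
      rw [← ofReal_norm, ← ofReal_norm]
      refine ENNReal.ofReal_le_ofReal ?_
      exact (hC _ _ ξ (hsub τ ξ)).trans (Real.le_norm_self _)
    · have := (memLp_two_inv_one_add_sq.const_mul (2 * A * C)).eLpNorm_lt_top
      rw [eLpNorm_lt_top_iff_lintegral_rpow_enorm_lt_top (by norm_num) (by norm_num)] at this
      simpa using this.ne
    · refine ae_of_all _ fun ξ => ?_
      have h1 : Continuous fun τ => a τ ξ := ha.comp (by fun_prop : Continuous fun τ : ℝ => (τ, ξ))
      have h2 : Continuous fun τ => ‖(((1 + ξ ^ 2) ^ (σ / 2) : ℝ) : ℂ) * (a τ - a t) ξ‖ₑ ^ (2 : ℝ) := by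
        refine ENNReal.continuous_rpow_const.comp (Continuous.enorm ?_)
        simp only [Pi.sub_apply]
        fun_prop
      simpa using h2.tendsto t
  rw [lintegral_zero] at hlim
  have := (ENNReal.continuous_rpow_const (y := 1 / (2 : ℝ))).tendsto 0 |>.comp hlim
  rw [ENNReal.zero_rpow_of_pos (by norm_num)] at this
  exact this

end IsRapidlyDecaying

/-! ### From Duhamel's formula to smooth solutions -/

lemma hasDerivAt_propagator (t ξ : ℝ) :
    HasDerivAt (fun t => propagator t ξ) (-Complex.I * schrodingerSymbol ξ * propagator t ξ) t := by
  have h1 : HasDerivAt (fun t : ℝ => (-(t * schrodingerSymbol ξ : ℝ) : ℂ) * Complex.I)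
      (-(1 * schrodingerSymbol ξ : ℝ) * Complex.I) t :=
    ((((hasDerivAt_id t).mul_const (schrodingerSymbol ξ)).ofReal_comp).neg).mul_const Complex.I
  have h2 := h1.cexp
  unfold propagator
  refine h2.congr_deriv ?_
  push_cast
  ring

lemma propagator_mul_propagator_neg (t ξ : ℝ) : propagator t ξ * propagator (-t) ξ = 1 := by
  unfold propagator
  rw [← Complex.exp_add]
  simp

namespace IsCorrelationWeight

variable {w : ℝ → ℝ} {κ : ℝ}

lemma hasDerivAt_duhamel (hw : IsCorrelationWeight w κ) (a₀ : ℝ → ℂ)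
    {a : ℝ → ℝ → ℂ} (ha : Continuous a.uncurry) {A : ℝ}
    (hA : 0 ≤ A) (haw : ∀ t ξ, ‖a t ξ‖ ≤ A * w ξ) (t ξ : ℝ) :
    HasDerivAt (fun t => duhamel a₀ a t ξ) (-Complex.I * (schrodingerSymbol ξ * duhamel a₀ a t ξ
      + correlation (a t) (a t) ξ)) t := by
  have hc : Continuous fun s => propagator (-s) ξ * correlation (a s) (a s) ξ :=
    (hw.continuous_duhamel_integrand ha hA haw).comp (by fun_prop : Continuous fun s => (s, ξ))
  have h1 := (hasDerivAt_propagator t ξ).mul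
    (((intervalIntegral.integral_hasDerivAt_right (hc.intervalIntegrable 0 t)
      (hc.stronglyMeasurableAtFilter _ _) hc.continuousAt).const_mul Complex.I).const_sub (a₀ ξ))
  refine h1.congr_deriv ?_
  unfold duhamel
  linear_combination (-Complex.I * correlation (a t) (a t) ξ) * propagator_mul_propagator_neg t ξ

/-- Differentiation under the integral. The derivative costs a factor `ξ²`, which the decay of the
weight absorbs; the Duhamel bound grows with `|t|`, so the majorant is taken on a unit ball in time.
-/
lemma hasDerivAt_integral_duhamel_mul (hw : IsCorrelationWeight w κ) (hdec : IsRapidlyDecaying w)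
    {a₀ : ℝ → ℂ} (ha₀c : Continuous a₀) (ha₀ : ∀ ξ, ‖a₀ ξ‖ ≤ w ξ)
    {a : ℝ → ℝ → ℂ} (ha : Continuous a.uncurry) {A : ℝ} (hA : 0 ≤ A)
    (haw : ∀ t ξ, ‖a t ξ‖ ≤ A * w ξ) {ψ : ℝ → ℂ} (hψ : Continuous ψ) {M : ℝ}
    (hM : ∀ ξ, ‖ψ ξ‖ ≤ M) (t : ℝ) :
    HasDerivAt (fun τ => ∫ ξ, duhamel a₀ a τ ξ * ψ ξ)
      (∫ ξ, -Complex.I * (schrodingerSymbol ξ * duhamel a₀ a t ξ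
        + correlation (a t) (a t) ξ) * ψ ξ) t := by
  have hκ := hw.const_nonneg
  have hM0 : 0 ≤ M := (norm_nonneg _).trans (hM 0)
  have hdc := hw.continuous_duhamel ha₀c ha hA haw
  have hdt : ∀ τ, Continuous (duhamel a₀ a τ) := fun τ =>
    hdc.comp (by fun_prop : Continuous fun ξ : ℝ => (τ, ξ))
  have hcc : Continuous fun ξ => correlation (a t) (a t) ξ :=
    (hw.continuous_correlation ha ha hA hA haw haw).comp
      (by fun_prop : Continuous fun ξ : ℝ => (t, ξ))
  set B : ℝ := 1 + A * A * κ * (|t| + 1) with hB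
  have hB0 : 0 ≤ B := by positivity
  have hdB : ∀ τ ∈ Metric.ball t 1, ∀ ξ, ‖duhamel a₀ a τ ξ‖ ≤ B * w ξ := fun τ hτ ξ => by
    refine (hw.norm_duhamel_le ha₀ hA haw τ ξ).trans
      (mul_le_mul_of_nonneg_right ?_ (hw.pos ξ).le)
    have : |τ| ≤ |t| + 1 := by
      have h1 := Metric.mem_ball.1 hτ
      rw [Real.dist_eq] at h1
      have h2 := abs_add_le t (τ - t)
      rw [add_sub_cancel] at h2
      linarith
    rw [hB]
    gcongr
  have hdom := hdec.integrable_sq_mul hw.pos hw.continuous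
  refine (hasDerivAt_integral_of_dominated_loc_of_deriv_le (𝕜 := ℝ)
    (F' := fun τ ξ => -Complex.I * (schrodingerSymbol ξ * duhamel a₀ a τ ξ
        + correlation (a τ) (a τ) ξ) * ψ ξ)
    (bound := fun ξ => (4 * Real.pi ^ 2 * B + A * A * κ) * M * ((1 + ξ ^ 2) * w ξ))
    (Metric.ball_mem_nhds t one_pos) ?_ ?_ ?_ ?_ ?_ ?_).2
  · exact Eventually.of_forall fun τ => ((hdt τ).mul hψ).aestronglyMeasurable
  · exact (hw.integrable_of_le (hdt t) (hdB t (Metric.mem_ball_self one_pos))).mul_bdd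
      (c := M) hψ.aestronglyMeasurable (ae_of_all _ hM)
  · have := hdt t
    exact (by fun_prop : Continuous _).aestronglyMeasurable
  · refine ae_of_all _ fun ξ τ hτ => ?_
    have h1 : ‖(schrodingerSymbol ξ : ℂ) * duhamel a₀ a τ ξ‖ ≤ 4 * Real.pi ^ 2 * ξ ^ 2 * (B * w ξ) := by
      rw [norm_mul, Complex.norm_real, Real.norm_of_nonneg (by unfold schrodingerSymbol; positivity),
        schrodingerSymbol]
      exact mul_le_mul_of_nonneg_left (hdB τ hτ ξ) (by positivity)
    have h2 := hw.norm_correlation_le hA hA (haw τ) (haw τ) ξ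
    have h3 := norm_add_le ((schrodingerSymbol ξ : ℂ) * duhamel a₀ a τ ξ)
      (correlation (a τ) (a τ) ξ)
    have hw0 := (hw.pos ξ).le
    rw [norm_mul, norm_mul, norm_neg, Complex.norm_I, one_mul]
    calc _ ≤ (4 * Real.pi ^ 2 * ξ ^ 2 * (B * w ξ) + A * A * κ * w ξ) * M :=
          mul_le_mul (h3.trans (add_le_add h1 h2)) (hM ξ) (norm_nonneg _) (by positivity)
      _ ≤ (4 * Real.pi ^ 2 * (1 + ξ ^ 2) * (B * w ξ) + A * A * κ * ((1 + ξ ^ 2) * w ξ)) * M := by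
          gcongr
          · linarith
          · nlinarith [mul_nonneg (sq_nonneg ξ) hw0]
      _ = _ := by ring
  · exact hdom.const_mul _
  · exact ae_of_all _ fun ξ τ _ => (hw.hasDerivAt_duhamel a₀ ha hA haw τ ξ).mul_const _

/-- A solution of Duhamel's formula on the Fourier side is the Fourier transform of a smooth
solution. -/
theorem isSmoothSolution (hw : IsCorrelationWeight w κ) (hdec : IsRapidlyDecaying w)
    {a₀ : 𝓢(ℝ, ℂ)} (ha₀ : ∀ ξ, ‖a₀ ξ‖ ≤ w ξ)
    {a : ℝ → ℝ → ℂ} (ha : Continuous a.uncurry) {A : ℝ} (hA : 0 ≤ A)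
    (haw : ∀ t ξ, ‖a t ξ‖ ≤ A * w ξ) {T : ℝ} (hT : 0 ≤ T)
    (hduh : ∀ t ∈ Icc 0 T, ∀ ξ, a t ξ = duhamel a₀ a t ξ) (hmem : ∀ t, MemLp (a t) 2) :
    IsSmoothSolution T (𝓕⁻ a₀) fun t => ofFourier (hmem t) where
  regular σ := hdec.continuousInSobolev_ofFourier hw.pos ha haw hmem σ T
  initial := by
    rw [← SchwartzMap.toLp_fourierInv_eq, ofFourier]
    congr 1
    have h0 : a 0 = a₀ := by
      ext ξ
      rw [hduh 0 ⟨le_rfl, hT⟩ ξ]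
      simp [duhamel]
    rw [SchwartzMap.toLp]
    congr 1
  equation φ t ht := by
    have hac : ∀ t, Continuous (a t) := fun t =>
      ha.comp (by fun_prop : Continuous fun ξ : ℝ => (t, ξ))
    have hint : ∀ t, Integrable (a t) := fun t => hw.integrable_of_le (hac t) (haw t)
    have hψ : 𝓕⁻ (φ : ℝ → ℂ) = ((𝓕⁻ φ : 𝓢(ℝ, ℂ)) : ℝ → ℂ) := (SchwartzMap.fourierInv_coe φ).symm
    obtain ⟨M, hM⟩ : ∃ M, ∀ ξ, ‖𝓕⁻ (φ : ℝ → ℂ) ξ‖ ≤ M := by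
      rw [hψ]
      obtain ⟨M, hM⟩ := (𝓕⁻ φ).decay 0 0
      exact ⟨M, fun ξ => by simpa using hM.2 ξ⟩
    have hψc : Continuous (𝓕⁻ (φ : ℝ → ℂ)) := hψ ▸ (𝓕⁻ φ).continuous
    have hlin : ∀ τ, ∫ x, ofFourier (hmem τ) x * φ x = ∫ ξ, a τ ξ * 𝓕⁻ (φ : ℝ → ℂ) ξ :=
      fun τ => integral_ofFourier_mul (hmem τ) φ
    have hder := hw.hasDerivAt_integral_duhamel_mul hdec a₀.continuous ha₀ ha hA haw hψc hM t
    have hcorr : Integrable (correlation (a t) (a t)) := by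
      refine hw.integrable_of_le (A := A * A * κ) ?_ (hw.norm_correlation_le hA hA (haw t) (haw t))
      exact (hw.continuous_correlation ha ha hA hA haw haw).comp
        (by fun_prop : Continuous fun ξ : ℝ => (t, ξ))
    have hnl : ∫ x, ofFourier (hmem t) x * conj (ofFourier (hmem t) x) * φ x
        = ∫ ξ, correlation (a t) (a t) ξ * 𝓕⁻ (φ : ℝ → ℂ) ξ := by
      rw [← integral_fourierInv_mul_eq hcorr φ.integrable]
      refine integral_congr_ae ?_
      filter_upwards [ofFourier_ae_eq (hmem t) (hint t)] with x hx
      rw [hx, fourierInv_mul_conj (hint t)]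
    have hlap : ∫ x, ofFourier (hmem t) x * iteratedDeriv 2 φ x
        = ∫ ξ, a t ξ * (-(schrodingerSymbol ξ : ℂ) * 𝓕⁻ (φ : ℝ → ℂ) ξ) := by
      have h := integral_ofFourier_mul (hmem t)
        (SchwartzMap.derivCLM ℂ ℂ (SchwartzMap.derivCLM ℂ ℂ φ))
      have h2 : ((SchwartzMap.derivCLM ℂ ℂ (SchwartzMap.derivCLM ℂ ℂ φ) : 𝓢(ℝ, ℂ)) : ℝ → ℂ)
          = iteratedDeriv 2 φ := by
        ext x
        rw [iteratedDeriv_succ, iteratedDeriv_one, SchwartzMap.derivCLM_apply]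
        congr 1
      rw [h2] at h
      simp_rw [h, fourierInv_iteratedDeriv_two]
    have hi1 : Integrable fun ξ => a t ξ * (-(schrodingerSymbol ξ : ℂ) * 𝓕⁻ (φ : ℝ → ℂ) ξ) := by
      refine ((hdec.integrable_sq_mul hw.pos hw.continuous).const_mul
        (4 * Real.pi ^ 2 * A * M)).mono' ?_ (ae_of_all _ fun ξ => ?_)
      · have := hac t
        exact (by fun_prop : Continuous _).aestronglyMeasurable
      · have hM0 : 0 ≤ M := (norm_nonneg _).trans (hM 0)
        have hw0 := (hw.pos ξ).le
        rw [norm_mul, norm_mul, norm_neg, Complex.norm_real,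
          Real.norm_of_nonneg (by unfold schrodingerSymbol; positivity), schrodingerSymbol]
        calc _ ≤ (A * w ξ) * (4 * Real.pi ^ 2 * (1 + ξ ^ 2) * M) := by
              gcongr
              · exact haw t ξ
              · linarith
              · exact hM ξ
          _ = _ := by ring
    have hi2 : Integrable fun ξ => correlation (a t) (a t) ξ * 𝓕⁻ (φ : ℝ → ℂ) ξ :=
      hcorr.mul_bdd (c := M) hψc.aestronglyMeasurable (ae_of_all _ hM)
    rw [hnl, hlap, ← integral_sub hi1 hi2, ← integral_const_mul]
    refine (hder.hasDerivWithinAt.congr_deriv ?_).congr (fun τ hτ => ?_) ?_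
    · congr 1
      ext ξ
      rw [← hduh t ht ξ]
      ring
    · rw [hlin τ]; simp_rw [hduh τ hτ]
    · rw [hlin t]; simp_rw [hduh t ht]

end IsCorrelationWeight

/-! ### The comb weight -/

/-- The profile `(1 + x²)⁻¹`. -/
def lorentzian (x : ℝ) : ℝ := (1 + x ^ 2)⁻¹

lemma lorentzian_pos (x : ℝ) : 0 < lorentzian x := by unfold lorentzian; positivity

lemma lorentzian_le_one (x : ℝ) : lorentzian x ≤ 1 :=
  inv_le_one_of_one_le₀ (by nlinarith [sq_nonneg x])

@[fun_prop]
lemma continuous_lorentzian : Continuous lorentzian :=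
  Continuous.inv₀ (by fun_prop) fun ξ => by positivity

/-- After clearing denominators the difference of the two sides is `3 + (y + z)²`. The factor in `y
- z` leaves the integral over a common translation, so correlating Lorentzians reproduces their
profile. -/
lemma lorentzian_mul_le (y z : ℝ) :
    lorentzian y * lorentzian z ≤ 2 * lorentzian (y - z) * (lorentzian y + lorentzian z) := by
  unfold lorentzian
  have h1 : 0 < 1 + y ^ 2 := by positivity
  have h2 : 0 < 1 + z ^ 2 := by positivity
  have h3 : 0 < 1 + (y - z) ^ 2 := by positivity
  rw [← sub_nonneg]
  have : 2 * (1 + (y - z) ^ 2)⁻¹ * ((1 + y ^ 2)⁻¹ + (1 + z ^ 2)⁻¹)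
      - (1 + y ^ 2)⁻¹ * (1 + z ^ 2)⁻¹
      = (3 + (y + z) ^ 2) * ((1 + (y - z) ^ 2)⁻¹ * (1 + y ^ 2)⁻¹ * (1 + z ^ 2)⁻¹) := by
    field_simp
    ring
  rw [this]
  positivity

lemma summable_lorentzian : Summable fun k : ℤ => lorentzian k := by
  -- The extra `1` at `k = 0` is needed because `1 / 0 = 0`, while the Lorentzian is `1` there.
  have h : Summable fun k : ℤ => 2 * (1 / |(k : ℝ)| ^ (2 : ℝ)) + if k = 0 then 1 else 0 :=
    ((Real.summable_one_div_int_pow.2 one_lt_two).congr (fun k => by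
      simp) |>.mul_left 2).add (summable_of_hasFiniteSupport
        ((Set.finite_singleton (0 : ℤ)).subset fun k hk => by simpa using hk))
  refine h.of_nonneg_of_le (fun k => (lorentzian_pos _).le) fun k => ?_
  rcases eq_or_ne k 0 with rfl | hk
  · simp [lorentzian]
  · have hk' : 0 < (k : ℝ) ^ 2 := by positivity
    simp only [hk, if_false, add_zero, Real.rpow_two, sq_abs, lorentzian, one_div]
    have : (1 + (k : ℝ) ^ 2)⁻¹ ≤ ((k : ℝ) ^ 2)⁻¹ := inv_anti₀ hk' (by linarith)
    have : 0 < ((k : ℝ) ^ 2)⁻¹ := by positivity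
    linarith

/-- The sum of `(1 + k²)⁻¹` over the integers. -/
def lorentzianSum : ℝ := ∑' k : ℤ, lorentzian k

lemma lorentzianSum_pos : 0 < lorentzianSum :=
  summable_lorentzian.tsum_pos (fun _ => (lorentzian_pos _).le) 0 (lorentzian_pos _)

/-- Peaks of width `1/N` at the integer multiples of `N`. -/
def lorentzianComb (N ξ : ℝ) : ℝ := ∑' k : ℤ, lorentzian k * lorentzian (N * (ξ - k * N))

lemma summable_lorentzianComb (N ξ : ℝ) :
    Summable fun k : ℤ => lorentzian k * lorentzian (N * (ξ - k * N)) :=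
  summable_lorentzian.of_nonneg_of_le
    (fun _ => mul_nonneg (lorentzian_pos _).le (lorentzian_pos _).le)
    fun _ => mul_le_of_le_one_right (lorentzian_pos _).le (lorentzian_le_one _)

lemma le_lorentzianComb (N ξ : ℝ) (k : ℤ) :
    lorentzian k * lorentzian (N * (ξ - k * N)) ≤ lorentzianComb N ξ :=
  (summable_lorentzianComb N ξ).le_tsum k
    fun _ _ => mul_nonneg (lorentzian_pos _).le (lorentzian_pos _).le

lemma lorentzianComb_pos (N ξ : ℝ) : 0 < lorentzianComb N ξ :=
  (mul_pos (lorentzian_pos _) (lorentzian_pos _)).trans_le (le_lorentzianComb N ξ 0)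

lemma lorentzianComb_le (N ξ : ℝ) : lorentzianComb N ξ ≤ lorentzianSum :=
  (summable_lorentzianComb N ξ).tsum_le_tsum
    (fun _ => mul_le_of_le_one_right (lorentzian_pos _).le (lorentzian_le_one _))
    summable_lorentzian

@[fun_prop]
lemma continuous_lorentzianComb (N : ℝ) : Continuous (lorentzianComb N) := by
  refine continuous_tsum (fun k => by fun_prop) summable_lorentzian fun k ξ => ?_
  rw [Real.norm_of_nonneg (mul_nonneg (lorentzian_pos _).le (lorentzian_pos _).le)]
  exact mul_le_of_le_one_right (lorentzian_pos _).le (lorentzian_le_one _)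

lemma lintegral_lorentzian_comp {N : ℝ} (hN : 0 < N) (c : ℝ) :
    ∫⁻ η, ENNReal.ofReal (lorentzian (N * (η - c))) = ENNReal.ofReal (Real.pi / N) := by
  have h0 : Integrable lorentzian := integrable_inv_one_add_sq
  have h1 : Integrable fun η => lorentzian (N * (η - c)) :=
    (h0.comp_mul_left' hN.ne').comp_sub_right c
  rw [← ofReal_integral_eq_lintegral_ofReal h1 (ae_of_all _ fun _ => (lorentzian_pos _).le),
    integral_sub_right_eq_self (fun η => lorentzian (N * η)) c, Measure.integral_comp_mul_left]
  simp only [lorentzian, integral_univ_inv_one_add_sq, smul_eq_mul, abs_of_pos (inv_pos.2 hN)]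
  congr 1
  field_simp

/-- Peaks `k` and `l` correlate into peak `k - l`. Applying `lorentzian_mul_le` to the indices and
to the rescaled positions separates the `ξ`-dependence; the constant is `4` from these two uses,
`2π/N` from the integral and `2 lorentzianSum` from the double sum. In `ℝ≥0∞` the interchanges need
no summability. -/
lemma lintegral_lorentzianComb_mul_le {N : ℝ} (hN : 0 < N) (ξ : ℝ) :
    ∫⁻ η, ENNReal.ofReal (lorentzianComb N η * lorentzianComb N (η - ξ))
      ≤ ENNReal.ofReal (16 * Real.pi * lorentzianSum / N * lorentzianComb N ξ) := by
  set F : ℝ → ℝ≥0∞ := fun x => ENNReal.ofReal (lorentzian x) with hF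
  have hFm : Measurable F := by fun_prop
  have hV : ∀ x, ENNReal.ofReal (lorentzianComb N x) = ∑' k : ℤ, F k * F (N * (x - k * N)) := by
    intro x
    rw [lorentzianComb, ENNReal.ofReal_tsum_of_nonneg
      (fun _ => mul_nonneg (lorentzian_pos _).le (lorentzian_pos _).le)
      (summable_lorentzianComb N x)]
    simp only [hF, ENNReal.ofReal_mul (lorentzian_pos _).le]
  have hS : ENNReal.ofReal lorentzianSum = ∑' k : ℤ, F k := by
    rw [lorentzianSum, ENNReal.ofReal_tsum_of_nonneg (fun _ => (lorentzian_pos _).le)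
      summable_lorentzian]
  have hFF : ∀ y z, F y * F z ≤ 2 * F (y - z) * (F y + F z) := fun y z => by
    simp only [hF]
    rw [← ENNReal.ofReal_mul (lorentzian_pos _).le,
      ← ENNReal.ofReal_add (lorentzian_pos _).le (lorentzian_pos _).le,
      show (2 : ℝ≥0∞) = ENNReal.ofReal 2 by simp, ← ENNReal.ofReal_mul (by norm_num),
      ← ENNReal.ofReal_mul (mul_nonneg (by norm_num) (lorentzian_pos _).le)]
    exact ENNReal.ofReal_le_ofReal (lorentzian_mul_le y z)
  have hFi : ∀ c, ∫⁻ η, F (N * (η - c)) = ENNReal.ofReal (Real.pi / N) :=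
    lintegral_lorentzian_comp hN
  set P := ENNReal.ofReal (Real.pi / N) with hP
  set G : ℤ → ℝ≥0∞ := fun j => F j * F (N * (ξ - j * N)) with hG
  have hpt : ∀ (k l : ℤ) (η : ℝ), F k * F (N * (η - k * N)) * (F l * F (N * (η - ξ - l * N)))
      ≤ 4 * G (k - l) * (F k + F l) * (F (N * (η - k * N)) + F (N * (η - (ξ + l * N)))) := by
    intro k l η
    have h1 := hFF k l
    have h2 := hFF (N * (η - k * N)) (N * (η - ξ - l * N))
    have e2 : N * (η - k * N) - N * (η - ξ - l * N) = N * (ξ - ((k - l : ℤ) : ℝ) * N) := by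
      push_cast; ring
    rw [e2] at h2
    calc _ = F k * F l * (F (N * (η - k * N)) * F (N * (η - ξ - l * N))) := by ring
      _ ≤ _ := mul_le_mul' h1 h2
      _ = _ := by
        rw [hG, sub_sub]
        push_cast
        ring
  calc ∫⁻ η, ENNReal.ofReal (lorentzianComb N η * lorentzianComb N (η - ξ))
      = ∫⁻ η, ∑' k : ℤ, ∑' l : ℤ,
          F k * F (N * (η - k * N)) * (F l * F (N * (η - ξ - l * N))) := by
        congr 1
        ext η
        rw [ENNReal.ofReal_mul (lorentzianComb_pos _ _).le, hV, hV, ← ENNReal.tsum_mul_right]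
        simp_rw [ENNReal.tsum_mul_left]
    _ ≤ ∫⁻ η, ∑' k : ℤ, ∑' l : ℤ, 4 * G (k - l) * (F k + F l) *
          (F (N * (η - k * N)) + F (N * (η - (ξ + l * N)))) :=
        lintegral_mono fun η => ENNReal.tsum_le_tsum fun k => ENNReal.tsum_le_tsum fun l =>
          hpt k l η
    _ = ∑' k : ℤ, ∑' l : ℤ, 4 * G (k - l) * (F k + F l) * (P + P) := by
        rw [lintegral_tsum fun k => (Measurable.tsum fun l => by fun_prop).aemeasurable]
        congr 1
        ext k
        rw [lintegral_tsum fun l => by fun_prop]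
        congr 1
        ext l
        rw [lintegral_const_mul _ (by fun_prop), lintegral_add_left (by fun_prop), hFi, hFi]
    _ = 8 * P * ((∑' k : ℤ, ∑' l : ℤ, F k * G (k - l)) + ∑' k : ℤ, ∑' l : ℤ, F l * G (k - l)) := by
        rw [← ENNReal.tsum_add, ← ENNReal.tsum_mul_left]
        congr 1
        ext k
        rw [← ENNReal.tsum_add, ← ENNReal.tsum_mul_left]
        congr 1
        ext l
        ring
    _ = 8 * P * ((∑' k : ℤ, F k) * (∑' j : ℤ, G j) + (∑' k : ℤ, F k) * (∑' j : ℤ, G j)) := by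
        congr 2
        · rw [← ENNReal.tsum_mul_right]
          congr 1
          ext k
          exact ENNReal.tsum_mul_left.trans (congrArg _ ((Equiv.subLeft k).tsum_eq G))
        · rw [ENNReal.tsum_comm, ← ENNReal.tsum_mul_right]
          congr 1
          ext l
          exact ENNReal.tsum_mul_left.trans (congrArg _ ((Equiv.subRight l).tsum_eq G))
    _ = ENNReal.ofReal (16 * Real.pi * lorentzianSum / N * lorentzianComb N ξ) := by
        rw [← hV, ← hS, hP, ← ENNReal.ofReal_mul lorentzianSum_pos.le,
          ← ENNReal.ofReal_add (by have := lorentzianSum_pos; have := lorentzianComb_pos N ξ; positivity)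
            (by have := lorentzianSum_pos; have := lorentzianComb_pos N ξ; positivity),
          show (8 : ℝ≥0∞) = ENNReal.ofReal 8 by simp, ← ENNReal.ofReal_mul (by norm_num),
          ← ENNReal.ofReal_mul (by positivity)]
        congr 1
        ring

/-- The weight adapted to data concentrated at frequency `N` on an interval of length `1/N`. -/
def combWeight (K N ξ : ℝ) : ℝ := K * Real.exp (-|ξ| / N) * lorentzianComb N ξ

section combWeight

variable {K N : ℝ}

lemma combWeight_pos (hK : 0 < K) (ξ : ℝ) : 0 < combWeight K N ξ :=
  mul_pos (mul_pos hK (Real.exp_pos _)) (lorentzianComb_pos _ _)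

lemma combWeight_le (hK : 0 < K) (hN : 0 < N) (ξ : ℝ) :
    combWeight K N ξ ≤ K * lorentzianSum := by
  have h1 : Real.exp (-|ξ| / N) ≤ 1 :=
    Real.exp_le_one_iff.2 (div_nonpos_of_nonpos_of_nonneg (by simp) hN.le)
  exact mul_le_mul (mul_le_of_le_one_right hK.le h1) (lorentzianComb_le _ _)
    (lorentzianComb_pos _ _).le hK.le

lemma continuous_combWeight : Continuous (combWeight K N) := by
  unfold combWeight; fun_prop

lemma isRapidlyDecaying_combWeight (hK : 0 < K) (hN : 0 < N) :
    IsRapidlyDecaying (combWeight K N) := by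
  intro k
  refine ⟨(2 * k).factorial * N ^ (2 * k) * Real.exp (1 / N) * (K * lorentzianSum), fun ξ => ?_⟩
  -- The exponential series bounds `x^(2k) / (2k)!` by `e^x`, at `x = (1 + |ξ|) / N`.
  have h1 := Real.pow_div_factorial_le_exp ((1 + |ξ|) / N) (by positivity) (2 * k)
  rw [div_le_iff₀ (by positivity), div_pow, div_le_iff₀ (by positivity), add_div,
    Real.exp_add] at h1
  have h2 : (1 + ξ ^ 2) ^ k ≤ (1 + |ξ|) ^ (2 * k) := by
    rw [pow_mul]
    gcongr
    nlinarith [abs_nonneg ξ, sq_abs ξ]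
  have h3 : Real.exp (|ξ| / N) * Real.exp (-|ξ| / N) = 1 := by
    rw [← Real.exp_add, ← add_div]; simp
  have hS := lorentzianSum_pos
  calc (1 + ξ ^ 2) ^ k * combWeight K N ξ
      ≤ (Real.exp (1 / N) * Real.exp (|ξ| / N) * (2 * k).factorial * N ^ (2 * k)) *
          (K * Real.exp (-|ξ| / N) * lorentzianSum) := by
        refine mul_le_mul (h2.trans h1) ?_ (combWeight_pos hK ξ).le (by positivity)
        exact mul_le_mul_of_nonneg_left (lorentzianComb_le _ _) (by positivity)
    _ = (2 * k).factorial * N ^ (2 * k) * Real.exp (1 / N) * (K * lorentzianSum) *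
          (Real.exp (|ξ| / N) * Real.exp (-|ξ| / N)) := by ring
    _ = _ := by rw [h3, mul_one]

lemma isCorrelationWeight_combWeight (hK : 0 < K) (hN : 0 < N) :
    IsCorrelationWeight (combWeight K N) (16 * Real.pi * lorentzianSum * K / N) where
  continuous := continuous_combWeight
  pos := combWeight_pos hK
  bounded := ⟨_, combWeight_le hK hN⟩
  integrable := by
    obtain ⟨C, hC⟩ := isRapidlyDecaying_combWeight hK hN 1
    refine (integrable_inv_one_add_sq.const_mul C).mono'
      continuous_combWeight.aestronglyMeasurable (ae_of_all _ fun ξ => ?_)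
    have h0 : (0 : ℝ) < 1 + ξ ^ 2 := by positivity
    rw [Real.norm_of_nonneg (combWeight_pos hK ξ).le, ← div_eq_mul_inv, le_div_iff₀ h0]
    simpa [mul_comm] using hC ξ
  correlation_le ξ := by
    have hS := lorentzianSum_pos
    -- By `|ξ| ≤ |η| + |η - ξ|` the exponential factor passes through the correlation without loss.
    have hE : ∀ η : ℝ, Real.exp (-|η| / N) * Real.exp (-|η - ξ| / N) ≤ Real.exp (-|ξ| / N) := by
      intro η
      rw [← Real.exp_add, ← add_div]
      refine Real.exp_le_exp.2 (div_le_div_of_nonneg_right ?_ hN.le)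
      have := abs_sub η (η - ξ)
      rw [sub_sub_cancel] at this
      linarith
    rw [integral_eq_lintegral_of_nonneg_ae
      (ae_of_all _ fun η => mul_nonneg (combWeight_pos hK _).le (combWeight_pos hK _).le)
      ((continuous_combWeight.mul
        (continuous_combWeight.comp (by fun_prop))).aestronglyMeasurable)]
    refine ENNReal.toReal_le_of_le_ofReal
      (mul_nonneg (by positivity) (combWeight_pos hK ξ).le) ?_
    calc ∫⁻ η, ENNReal.ofReal (combWeight K N η * combWeight K N (η - ξ))
        ≤ ∫⁻ η, ENNReal.ofReal (K ^ 2 * Real.exp (-|ξ| / N)) *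
            ENNReal.ofReal (lorentzianComb N η * lorentzianComb N (η - ξ)) := by
          refine lintegral_mono fun η => ?_
          rw [← ENNReal.ofReal_mul (by positivity)]
          refine ENNReal.ofReal_le_ofReal ?_
          have hp : 0 ≤ lorentzianComb N η * lorentzianComb N (η - ξ) :=
            mul_nonneg (lorentzianComb_pos _ _).le (lorentzianComb_pos _ _).le
          calc _ = K ^ 2 * (Real.exp (-|η| / N) * Real.exp (-|η - ξ| / N)) *
                (lorentzianComb N η * lorentzianComb N (η - ξ)) := by
                unfold combWeight; ring
            _ ≤ _ := by gcongr; exact hE η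
      _ ≤ ENNReal.ofReal (K ^ 2 * Real.exp (-|ξ| / N)) *
            ENNReal.ofReal (16 * Real.pi * lorentzianSum / N * lorentzianComb N ξ) := by
          rw [lintegral_const_mul' _ _ ENNReal.ofReal_ne_top]
          gcongr
          exact lintegral_lorentzianComb_mul_le hN ξ
      _ = _ := by
          rw [← ENNReal.ofReal_mul (by positivity)]
          congr 1
          unfold combWeight
          ring

/-- Only the peak `k = 1` is used: its coefficient is `1/2`, its profile is at least `1/5` on this
range, and `|ξ| ≤ 3N` costs `e⁻³`. The factor `10 e³` compensates. -/
lemma le_combWeight {M : ℝ} (hM : 0 < M) (hN : 1 ≤ N) {ξ : ℝ} (hξ : |N * (ξ - N)| ≤ 2) :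
    M ≤ combWeight (10 * Real.exp 3 * M) N ξ := by
  have hN0 : 0 < N := by linarith
  have h1 : lorentzian (1 : ℤ) * lorentzian (N * (ξ - (1 : ℤ) * N)) ≤ lorentzianComb N ξ :=
    le_lorentzianComb N ξ 1
  have h2 : 1 / 10 ≤ lorentzianComb N ξ := by
    refine le_trans ?_ h1
    rw [Int.cast_one, one_mul]
    have h3 : (N * (ξ - N)) ^ 2 ≤ 4 := by
      rw [← sq_abs]; nlinarith [abs_nonneg (N * (ξ - N))]
    have h4 : (1 : ℝ) / 5 ≤ lorentzian (N * (ξ - N)) := by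
      rw [lorentzian, one_div]
      exact inv_anti₀ (by positivity) (by linarith)
    have h5 : lorentzian 1 = 1 / 2 := by norm_num [lorentzian]
    rw [h5]; linarith
  have h6 : |ξ| ≤ 3 * N := by
    rw [abs_mul, abs_of_pos hN0] at hξ
    have h7 : |ξ - N| ≤ 2 * N := by nlinarith [abs_nonneg (ξ - N)]
    have h8 := abs_add_le (ξ - N) N
    rw [sub_add_cancel, abs_of_pos hN0] at h8
    linarith
  have h9 : Real.exp (-3) ≤ Real.exp (-|ξ| / N) := by
    refine Real.exp_le_exp.2 ?_
    rw [le_div_iff₀ hN0]; linarith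
  calc M = 10 * M * (Real.exp 3 * Real.exp (-3)) * (1 / 10) := by
        rw [← Real.exp_add]; norm_num; ring
    _ = 10 * Real.exp 3 * M * Real.exp (-3) * (1 / 10) := by ring
    _ ≤ _ := by unfold combWeight; gcongr

end combWeight

/-! ### The initial data and their resonant interaction -/

/-- A smooth function which equals `1` on `[-1,1]` and vanishes outside `(-2,2)`. -/
def unitBump : ContDiffBump (0 : ℝ) := ⟨1, 2, one_pos, one_lt_two⟩

/-- The Fourier transform of the initial data: a bump of height `m³` and width `m⁻⁴` at
frequency `m⁴`. -/
def bumpProfile (m ξ : ℝ) : ℝ := m ^ 3 * unitBump (m ^ 4 * (ξ - m ^ 4))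

section bumpProfile

variable {m : ℝ}

lemma bumpProfile_nonneg (hm : 0 < m) (ξ : ℝ) : 0 ≤ bumpProfile m ξ :=
  mul_nonneg (by positivity) unitBump.nonneg

lemma bumpProfile_le (hm : 0 < m) (ξ : ℝ) : bumpProfile m ξ ≤ m ^ 3 :=
  mul_le_of_le_one_right (by positivity) unitBump.le_one

lemma bumpProfile_eq_zero {ξ : ℝ} (hξ : 2 ≤ |m ^ 4 * (ξ - m ^ 4)|) : bumpProfile m ξ = 0 := by
  rw [bumpProfile, unitBump.zero_of_le_dist (by simpa [unitBump] using hξ), mul_zero]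

lemma bumpProfile_eq {ξ : ℝ} (hξ : |m ^ 4 * (ξ - m ^ 4)| ≤ 1) : bumpProfile m ξ = m ^ 3 := by
  rw [bumpProfile, unitBump.one_of_mem_closedBall (by simpa [unitBump] using hξ), mul_one]

lemma contDiff_bumpProfile : ContDiff ℝ (⊤ : ℕ∞) (bumpProfile m) := by
  unfold bumpProfile
  exact contDiff_const.mul (unitBump.contDiff.comp (by fun_prop))

lemma hasCompactSupport_bumpProfile (hm : 0 < m) : HasCompactSupport (bumpProfile m) := by
  refine HasCompactSupport.intro
    (isCompact_Icc (a := m ^ 4 - 2 / m ^ 4) (b := m ^ 4 + 2 / m ^ 4)) fun ξ hξ => ?_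
  refine bumpProfile_eq_zero ?_
  by_contra! h
  have hN : 0 < m ^ 4 := by positivity
  rw [abs_mul, abs_of_pos hN, mul_comm, ← lt_div_iff₀ hN, abs_lt] at h
  exact hξ ⟨by linarith, by linarith⟩

/-- The Fourier transform of the initial data as a Schwartz function. -/
def bumpData (hm : 0 < m) : 𝓢(ℝ, ℂ) :=
  HasCompactSupport.toSchwartzMap (f := fun ξ => (bumpProfile m ξ : ℂ))
    ((hasCompactSupport_bumpProfile hm).comp_left Complex.ofReal_zero)
    (Complex.ofRealCLM.contDiff.comp contDiff_bumpProfile)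

lemma bumpData_apply (hm : 0 < m) (ξ : ℝ) : bumpData hm ξ = bumpProfile m ξ := rfl

lemma norm_bumpData_apply (hm : 0 < m) (ξ : ℝ) : ‖bumpData hm ξ‖ = bumpProfile m ξ := by
  rw [bumpData_apply, Complex.norm_real, Real.norm_of_nonneg (bumpProfile_nonneg hm ξ)]

/-- The `H^s` norm of the initial data is `O(m^(1+4s))`. -/
lemma eLpNorm_bumpData_le (hm : 2 ≤ m) {s : ℝ} (hs : s < 0) :
    eLpNorm (fun ξ => (((1 + ξ ^ 2) ^ (s / 2) : ℝ) : ℂ) * bumpData (by linarith : 0 < m) ξ) 2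
      ≤ ENNReal.ofReal (2 ^ (1 - s) * m ^ (1 + 4 * s)) := by
  have hm0 : 0 < m := by linarith
  have hN : 0 < m ^ 4 := by positivity
  have hN2 : 16 ≤ m ^ 4 := by
    calc (16 : ℝ) = 2 ^ 4 := by norm_num
      _ ≤ m ^ 4 := by gcongr
  set c : ℝ := (m ^ 4 / 2) ^ s * m ^ 3 with hc
  set J : Set ℝ := Icc (m ^ 4 - 2 / m ^ 4) (m ^ 4 + 2 / m ^ 4)
  have hpt : ∀ ξ, ‖(((1 + ξ ^ 2) ^ (s / 2) : ℝ) : ℂ) * bumpData hm0 ξ‖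
      ≤ ‖J.indicator (fun _ => c) ξ‖ := by
    intro ξ
    by_cases hξ : ξ ∈ J
    · rw [indicator_of_mem hξ, norm_mul, norm_bumpData_apply, Complex.norm_real,
        Real.norm_of_nonneg (by positivity), Real.norm_of_nonneg (by positivity)]
      refine mul_le_mul ?_ (bumpProfile_le hm0 ξ) (bumpProfile_nonneg hm0 ξ) (by positivity)
      have h1 : 2 / m ^ 4 ≤ 1 := by rw [div_le_one hN]; linarith
      have h2 : m ^ 4 / 2 ≤ ξ := by linarith [hξ.1]
      -- As `s < 0`, the lower bound for the frequency gives the upper bound for the Sobolev factor.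
      have h3 : (m ^ 4 / 2) ^ 2 ≤ 1 + ξ ^ 2 := by nlinarith
      calc (1 + ξ ^ 2) ^ (s / 2) ≤ ((m ^ 4 / 2) ^ 2) ^ (s / 2) :=
            Real.rpow_le_rpow_of_nonpos (by positivity) h3 (by linarith)
        _ = (m ^ 4 / 2) ^ s := by
            rw [← Real.rpow_natCast, ← Real.rpow_mul (by positivity)]
            congr 1
            push_cast
            ring
    · have h0 : bumpProfile m ξ = 0 := by
        refine bumpProfile_eq_zero ?_
        by_contra! h
        rw [abs_mul, abs_of_pos hN, mul_comm, ← lt_div_iff₀ hN, abs_lt] at h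
        exact hξ ⟨by linarith, by linarith⟩
      rw [norm_mul, norm_bumpData_apply, h0, mul_zero]
      exact norm_nonneg _
  refine (eLpNorm_mono hpt).trans ?_
  rw [eLpNorm_indicator_const measurableSet_Icc (by norm_num) (by norm_num), Real.volume_Icc,
    ← ofReal_norm, Real.norm_of_nonneg (by positivity),
    ENNReal.ofReal_rpow_of_nonneg (by ring_nf; positivity) (by simp),
    ← ENNReal.ofReal_mul (by positivity)]
  refine ENNReal.ofReal_le_ofReal (le_of_eq ?_)
  have h4 : (m ^ 4 + 2 / m ^ 4 - (m ^ 4 - 2 / m ^ 4)) = (2 / m ^ 2) ^ 2 := by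
    field_simp; ring
  have h5 : (((2 / m ^ 2) ^ 2 : ℝ)) ^ (1 / (2 : ℝ≥0∞).toReal) = 2 / m ^ 2 := by
    rw [ENNReal.toReal_ofNat, ← Real.sqrt_eq_rpow, Real.sqrt_sq (by positivity)]
  rw [h4, h5, hc, Real.div_rpow (by positivity) (by norm_num), Real.rpow_sub (by norm_num),
    Real.rpow_add hm0, ← Real.rpow_natCast m 4, ← Real.rpow_mul hm0.le]
  simp only [Real.rpow_one]
  push_cast
  field_simp

/-- The squares of the high frequency cancel. What remains is bounded when `|ξ| ≤ 1/N` and `η` is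
near `N`. -/
lemma schrodingerSymbol_resonance (ξ η : ℝ) :
    schrodingerSymbol ξ - schrodingerSymbol η + schrodingerSymbol (η - ξ)
      = 8 * Real.pi ^ 2 * (ξ * (ξ - η)) := by
  unfold schrodingerSymbol; ring

lemma re_propagator_mul_propagator (τ ξ η x y : ℝ) :
    (propagator (-τ) ξ * ((propagator τ η * x) * conj (propagator τ (η - ξ) * y))).re
      = Real.cos (τ * (8 * Real.pi ^ 2 * (ξ * (ξ - η)))) * (x * y) := by
  have h : propagator (-τ) ξ * ((propagator τ η * x) * conj (propagator τ (η - ξ) * y))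
      = Complex.exp ((τ * (8 * Real.pi ^ 2 * (ξ * (ξ - η))) : ℝ) * Complex.I) *
        ((x * y : ℝ) : ℂ) := by
    rw [← schrodingerSymbol_resonance]
    simp only [propagator, map_mul, ← Complex.exp_conj, map_neg, Complex.conj_ofReal,
      Complex.conj_I]
    rw [show ∀ a b c d e : ℂ, a * (b * d * (c * e)) = (a * b * c) * (d * e) by intros; ring,
      ← Complex.exp_add, ← Complex.exp_add]
    push_cast
    congr 2
    ring
  rw [h, Complex.re_mul_ofReal, Complex.exp_ofReal_mul_I_re]

/-- The high-high-to-low interaction of the free solution is nearly resonant for short times. -/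
lemma le_re_correlation_free (hm : 2 ≤ m) {w : ℝ → ℝ} {κ : ℝ} (hw : IsCorrelationWeight w κ)
    (hmw : ∀ ξ, bumpProfile m ξ ≤ w ξ) {τ ξ : ℝ} (hτ : τ ∈ Icc 0 (1 / 160))
    (hξ : ξ ∈ Icc 0 (1 / m ^ 4)) :
    m ^ 2 / 2 ≤ (propagator (-τ) ξ * correlation (fun η => propagator τ η * bumpProfile m η)
      (fun η => propagator τ η * bumpProfile m η) ξ).re := by
  have hm0 : 0 < m := by linarith
  have hN : 0 < m ^ 4 := by positivity
  have hN2 : 16 ≤ m ^ 4 := by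
    calc (16 : ℝ) = 2 ^ 4 := by norm_num
      _ ≤ m ^ 4 := by gcongr
  have hbc : Continuous (bumpProfile m) := contDiff_bumpProfile.continuous
  have hfc : Continuous fun η => propagator τ η * (bumpProfile m η : ℂ) := by fun_prop
  have hfw : ∀ η, ‖propagator τ η * (bumpProfile m η : ℂ)‖ ≤ 1 * w η := fun η => by
    rw [norm_mul, norm_propagator, Complex.norm_real,
      Real.norm_of_nonneg (bumpProfile_nonneg hm0 η), one_mul, one_mul]
    exact hmw η
  have hint := (hw.integrable_mul_conj hfc hfc hfw hfw ξ).const_mul (propagator (-τ) ξ)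
  have hre := hint.re
  rw [correlation, ← integral_const_mul]
  have e1 : (∫ η, propagator (-τ) ξ * (propagator τ η * (bumpProfile m η : ℂ) *
      conj (propagator τ (η - ξ) * (bumpProfile m (η - ξ) : ℂ)))).re
      = ∫ η, Real.cos (τ * (8 * Real.pi ^ 2 * (ξ * (ξ - η)))) *
        (bumpProfile m η * bumpProfile m (η - ξ)) := by
    rw [← RCLike.re_eq_complex_re, ← integral_re hint]
    simp only [RCLike.re_eq_complex_re, re_propagator_mul_propagator]
  simp only [RCLike.re_eq_complex_re, re_propagator_mul_propagator] at hre
  rw [e1]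
  -- On `[N, N + 1/N]` both bumps equal `m³`. Elsewhere either the first bump vanishes or the cosine
  -- is positive, so dropping the rest only decreases the integral.
  have hpt : ∀ η, (Icc (m ^ 4) (m ^ 4 + 1 / m ^ 4)).indicator (fun _ => m ^ 6 / 2) η
      ≤ Real.cos (τ * (8 * Real.pi ^ 2 * (ξ * (ξ - η)))) *
        (bumpProfile m η * bumpProfile m (η - ξ)) := by
    intro η
    have hNξ : m ^ 4 * ξ ≤ 1 := by
      have := hξ.2
      rwa [le_div_iff₀ hN, mul_comm] at this
    by_cases hη : 2 ≤ |m ^ 4 * (η - m ^ 4)|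
    · rw [bumpProfile_eq_zero hη, zero_mul, mul_zero, indicator_of_notMem]
      rintro ⟨h1, h2⟩
      have h3 : m ^ 4 * (η - m ^ 4) ≤ 1 := by
        rw [← sub_le_iff_le_add', le_div_iff₀ hN, mul_comm] at h2
        exact h2
      have h4 : 0 ≤ m ^ 4 * (η - m ^ 4) := mul_nonneg hN.le (by linarith)
      rw [abs_of_nonneg h4] at hη
      linarith
    push Not at hη
    -- The phase is at most `τ · 8π² · 2 ≤ 160 τ ≤ 1`, using `π² ≤ 10`; this is where `1/160` comes
    -- from.
    have hcos : 1 / 2 ≤ Real.cos (τ * (8 * Real.pi ^ 2 * (ξ * (ξ - η)))) := by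
      have h1 : |ξ * (ξ - η)| ≤ 2 := by
        rw [abs_mul, abs_of_pos hN] at hη
        have h2 : |η - m ^ 4| ≤ 1 := by nlinarith [abs_nonneg (η - m ^ 4)]
        have h3 : ξ ≤ 1 := by nlinarith [hξ.1]
        have h4 : |ξ - η| ≤ 2 * m ^ 4 := by
          rw [abs_le] at h2 ⊢
          constructor <;> linarith [hξ.1]
        rw [abs_mul, abs_of_nonneg hξ.1]
        calc ξ * |ξ - η| ≤ ξ * (2 * m ^ 4) := mul_le_mul_of_nonneg_left h4 hξ.1
          _ ≤ 2 := by linarith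
      have h3 : |τ * (8 * Real.pi ^ 2 * (ξ * (ξ - η)))| ≤ 1 := by
        rw [abs_mul, abs_mul, abs_of_nonneg hτ.1, abs_of_nonneg (by positivity)]
        have h4 : Real.pi ^ 2 ≤ 10 := by nlinarith [Real.pi_lt_d2, Real.pi_pos]
        calc τ * (8 * Real.pi ^ 2 * |ξ * (ξ - η)|) ≤ 1 / 160 * (8 * 10 * 2) := by
              have := hτ.2
              gcongr
          _ = 1 := by norm_num
      have h5 := Real.one_sub_sq_div_two_le_cos (x := τ * (8 * Real.pi ^ 2 * (ξ * (ξ - η))))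
      have h6 := (sq_le_one_iff_abs_le_one _).2 h3
      linarith
    have hb : 0 ≤ bumpProfile m η * bumpProfile m (η - ξ) :=
      mul_nonneg (bumpProfile_nonneg hm0 _) (bumpProfile_nonneg hm0 _)
    by_cases hJ : η ∈ Icc (m ^ 4) (m ^ 4 + 1 / m ^ 4)
    · have h1 := hJ.1
      have h2 := hJ.2
      have h3 : m ^ 4 * (η - m ^ 4) ≤ 1 := by
        rw [← sub_le_iff_le_add', le_div_iff₀ hN, mul_comm] at h2
        exact h2
      have h4 : 0 ≤ m ^ 4 * (η - m ^ 4) := mul_nonneg hN.le (by linarith)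
      have h5 : 0 ≤ m ^ 4 * ξ := mul_nonneg hN.le hξ.1
      rw [indicator_of_mem hJ, bumpProfile_eq (by rwa [abs_of_nonneg h4]),
        bumpProfile_eq (by rw [abs_le]; constructor <;> linarith)]
      nlinarith [pow_pos hm0 6]
    · rw [indicator_of_notMem hJ]
      exact mul_nonneg (by linarith) hb
  calc m ^ 2 / 2 = ∫ η, (Icc (m ^ 4) (m ^ 4 + 1 / m ^ 4)).indicator (fun _ => m ^ 6 / 2) η := by
        rw [integral_indicator_const _ measurableSet_Icc, Measure.real, Real.volume_Icc,
          ENNReal.toReal_ofReal (by ring_nf; positivity), smul_eq_mul]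
        field_simp; ring
    _ ≤ _ := integral_mono
        ((integrable_indicator_iff measurableSet_Icc).2 (integrableOn_const (by simp))) hre hpt

end bumpProfile

/-! ### Lower bound at low frequency and norm inflation -/

/-- The low frequency part of the solution has size at least `t m² / 4`. -/
lemma le_norm_duhamel_solution {m : ℝ} (hm : 2 ≤ m) {w : ℝ → ℝ} {κ : ℝ}
    (hw : IsCorrelationWeight w κ) (hmw : ∀ ξ, bumpProfile m ξ ≤ w ξ)
    {a : ℝ → ℝ → ℂ} (ha : Continuous a.uncurry) (haw : ∀ t ξ, ‖a t ξ‖ ≤ 2 * w ξ) {T : ℝ}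
    (hduh : ∀ t ∈ Icc 0 T, ∀ ξ, a t ξ = duhamel (fun ξ => bumpProfile m ξ) a t ξ) {t : ℝ}
    (ht : t ∈ Icc 0 T) (ht' : t ≤ 1 / 160) {ξ : ℝ} (hξ : ξ ∈ Icc 0 (1 / m ^ 4))
    (hsmall : 12 * κ ^ 2 * T * w ξ ≤ m ^ 2 / 4) :
    t * (m ^ 2 / 4) ≤ ‖a t ξ‖ := by
  have hm0 : 0 < m := by linarith
  have hN : 0 < m ^ 4 := by positivity
  have hN2 : 16 ≤ m ^ 4 := by
    calc (16 : ℝ) = 2 ^ 4 := by norm_num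
      _ ≤ m ^ 4 := by gcongr
  have hκ := hw.const_nonneg
  have hbc : Continuous (bumpProfile m) := contDiff_bumpProfile.continuous
  have hT : 0 ≤ T := ht.1.trans ht.2
  -- The datum has no low frequencies, so `a t ξ` is the Duhamel integral alone.
  have hzero : bumpProfile m ξ = 0 := by
    refine bumpProfile_eq_zero ?_
    have h1 : m ^ 4 * ξ ≤ 1 := by
      have := hξ.2
      rwa [le_div_iff₀ hN, mul_comm] at this
    rw [abs_of_nonpos (by nlinarith)]
    nlinarith
  set g : ℝ → ℂ := fun s => propagator (-s) ξ * correlation (a s) (a s) ξ with hg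
  have hgc : Continuous g :=
    (hw.continuous_duhamel_integrand ha two_pos.le haw).comp
      (by fun_prop : Continuous fun s => (s, ξ))
  have hnorm : ‖a t ξ‖ = ‖∫ s in (0 : ℝ)..t, g s‖ := by
    rw [hduh t ht ξ, duhamel, hzero]
    simp [hg]
  have hge : ∀ s ∈ Icc 0 t, m ^ 2 / 4 ≤ (g s).re := by
    intro s hs
    have hsT : s ∈ Icc 0 T := ⟨hs.1, hs.2.trans ht.2⟩
    have h1 := le_re_correlation_free hm hw hmw ⟨hs.1, hs.2.trans ht'⟩ hξ
    set f : ℝ → ℂ := fun η => propagator s η * bumpProfile m η with hf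
    have hac : Continuous (a s) := ha.comp (by fun_prop : Continuous fun ξ : ℝ => (s, ξ))
    have hfw : ∀ η, ‖f η‖ ≤ 1 * w η := fun η => by
      rw [hf, norm_mul, norm_propagator, Complex.norm_real,
        Real.norm_of_nonneg (bumpProfile_nonneg hm0 η), one_mul, one_mul]
      exact hmw η
    -- The bound `2w` gives the deviation `2² κ T`. With the bounds `2` and `1` for `a` and `f`, the
    -- correlations then differ by at most `(2 + 1) · 4κT · κ w = 12 κ² T w`.
    have hd : ∀ η, ‖a s η - f η‖ ≤ (4 * κ * T) * w η := fun η => by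
      rw [hduh s hsT η]
      refine (hw.norm_duhamel_sub_le two_pos.le haw s η).trans ?_
      refine mul_le_mul_of_nonneg_right ?_ (hw.pos η).le
      rw [abs_of_nonneg hs.1]
      nlinarith [mul_le_mul_of_nonneg_left hsT.2 hκ]
    have h2 := hw.norm_correlation_sub_le hac (by fun_prop) two_pos.le one_pos.le
      (by positivity) (haw s) hfw hd ξ
    have h3 : ‖propagator (-s) ξ * (correlation (a s) (a s) ξ - correlation f f ξ)‖
        ≤ m ^ 2 / 4 := by
      rw [norm_mul, norm_propagator, one_mul]
      exact h2.trans ((le_of_eq (by ring)).trans hsmall)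
    have h4 := (abs_le.1 ((Complex.abs_re_le_norm _).trans h3)).1
    rw [mul_sub, Complex.sub_re] at h4
    change m ^ 2 / 4 ≤ (propagator (-s) ξ * correlation (a s) (a s) ξ).re
    linarith
  rw [hnorm]
  refine le_trans ?_ (Complex.re_le_norm _)
  have hre : (∫ s in (0 : ℝ)..t, g s).re = ∫ s in (0 : ℝ)..t, (g s).re :=
    (Complex.reCLM.intervalIntegral_comp_comm (hgc.intervalIntegrable 0 t)).symm
  rw [hre]
  have hgr : Continuous fun s => (g s).re := Complex.continuous_re.comp hgc
  have := intervalIntegral.integral_mono_on ht.1 (intervalIntegrable_const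
    (μ := volume) (c := m ^ 2 / 4)) (hgr.intervalIntegrable 0 t) hge
  rwa [intervalIntegral.integral_const, sub_zero, smul_eq_mul] at this

/-- Height `m²` on an interval of length `m⁻⁴` has an `L²` norm free of `m`; since `|ξ| ≤ 1` there,
the Sobolev factor is at least `2^(s/2)`. -/
lemma le_eLpNorm_of_low_frequency {m : ℝ} (hm : 2 ≤ m) {s : ℝ} (hs : s < 0) {f : ℝ → ℂ} {c : ℝ}
    (hc : 0 ≤ c) (hf : ∀ ξ ∈ Icc 0 (1 / m ^ 4), c * m ^ 2 ≤ ‖f ξ‖) :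
    ENNReal.ofReal (2 ^ (s / 2) * c)
      ≤ eLpNorm (fun ξ => (((1 + ξ ^ 2) ^ (s / 2) : ℝ) : ℂ) * f ξ) 2 := by
  have hm0 : 0 < m := by linarith
  have hN : 1 ≤ m ^ 4 := one_le_pow₀ (by linarith)
  have hpt : ∀ ξ, ‖(Icc 0 (1 / m ^ 4)).indicator (fun _ => 2 ^ (s / 2) * (c * m ^ 2)) ξ‖
      ≤ ‖(((1 + ξ ^ 2) ^ (s / 2) : ℝ) : ℂ) * f ξ‖ := by
    intro ξ
    by_cases hξ : ξ ∈ Icc 0 (1 / m ^ 4)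
    · rw [indicator_of_mem hξ, Real.norm_of_nonneg (by positivity), norm_mul, Complex.norm_real,
        Real.norm_of_nonneg (by positivity)]
      refine mul_le_mul ?_ (hf ξ hξ) (by positivity) (by positivity)
      refine Real.rpow_le_rpow_of_nonpos (by positivity) ?_ (by linarith)
      have h1 : 1 / m ^ 4 ≤ 1 := by rw [div_le_one (by positivity)]; exact hN
      nlinarith [hξ.1, hξ.2]
    · rw [indicator_of_notMem hξ, norm_zero]
      exact norm_nonneg _
  refine le_trans (le_of_eq ?_) (eLpNorm_mono hpt)
  rw [eLpNorm_indicator_const measurableSet_Icc (by norm_num) (by norm_num), Real.volume_Icc,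
    ← ofReal_norm, Real.norm_of_nonneg (by positivity),
    ENNReal.ofReal_rpow_of_nonneg (by rw [sub_zero]; positivity) (by simp),
    ← ENNReal.ofReal_mul (by positivity)]
  congr 1
  have h4 : 1 / m ^ 4 - 0 = (1 / m ^ 2) ^ 2 := by
    field_simp; ring
  have h5 : (((1 / m ^ 2) ^ 2 : ℝ)) ^ (1 / (2 : ℝ≥0∞).toReal) = 1 / m ^ 2 := by
    rw [ENNReal.toReal_ofNat, ← Real.sqrt_eq_rpow, Real.sqrt_sq (by positivity)]
  rw [h4, h5]
  field_simp

/-- The solution with the bump as initial data: it exists up to time `T` if the bump is narrow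
enough, and it has a low frequency part whose size does not depend on the bump. -/
lemma exists_isSmoothSolution_bumpData {s T : ℝ} (hs : s < 0) (hT : 0 < T) {t : ℝ}
    (ht : t ∈ Icc 0 T) (ht' : t ≤ 1 / 160) :
    ∀ᶠ m : ℝ in atTop, ∃ (u₀ : 𝓢(ℝ, ℂ)) (u : ℝ → Lp ℂ 2 (volume : Measure ℝ)),
      IsSmoothSolution T u₀ u ∧
      sobolevENorm s (u₀ : 𝓢'(ℝ, ℂ)) ≤ ENNReal.ofReal (2 ^ (1 - s) * m ^ (1 + 4 * s)) ∧
      ENNReal.ofReal (2 ^ (s / 2) * (t / 4))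
        ≤ sobolevENorm s (Lp.toTemperedDistribution (u t)) := by
  have hS := lorentzianSum_pos
  set D : ℝ := 10 * Real.exp 3 * lorentzianSum with hD
  have hD0 : 0 < D := by positivity
  -- As `κ = 16πD/m`, the second threshold is `κ T ≤ 1/8`. The third is `12 κ² T w ≤ m²/4` with `w`
  -- replaced by its bound `D m³`.
  filter_upwards [eventually_ge_atTop 2, eventually_ge_atTop (128 * Real.pi * D * T),
    eventually_ge_atTop (12288 * Real.pi ^ 2 * D ^ 3 * T)] with m hm hm1 hm2
  have hm0 : 0 < m := by linarith
  have hN : 1 ≤ m ^ 4 := one_le_pow₀ (by linarith)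
  have hN0 : 0 < m ^ 4 := by positivity
  set K : ℝ := 10 * Real.exp 3 * m ^ 3 with hK
  have hK0 : 0 < K := by positivity
  have hw := isCorrelationWeight_combWeight hK0 hN0
  have hdec := isRapidlyDecaying_combWeight hK0 hN0
  set w := combWeight K (m ^ 4)
  set κ := 16 * Real.pi * lorentzianSum * K / m ^ 4 with hκ
  have hκm : κ = 16 * Real.pi * D / m := by
    rw [hκ, hK, hD]; field_simp
  have hmw : ∀ ξ, bumpProfile m ξ ≤ w ξ := by
    intro ξ
    rcases le_total 2 |m ^ 4 * (ξ - m ^ 4)| with h | h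
    · rw [bumpProfile_eq_zero h]
      exact (hw.pos ξ).le
    · exact (bumpProfile_le hm0 ξ).trans (le_combWeight (by positivity) hN h)
  have ha₀ : ∀ ξ, ‖bumpData hm0 ξ‖ ≤ w ξ := fun ξ => by
    rw [norm_bumpData_apply]; exact hmw ξ
  obtain ⟨a, ha, haw, hduh⟩ := hw.exists_eq_duhamel (bumpData hm0).continuous ha₀ hT.le (by
    rw [hκm, div_mul_eq_mul_div, div_le_iff₀ hm0]
    linarith)
  have hac : ∀ t, Continuous (a t) := fun t =>
    ha.comp (by fun_prop : Continuous fun ξ : ℝ => (t, ξ))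
  have hmem : ∀ t, MemLp (a t) 2 := fun t => hdec.memLp hw.pos (hac t) (haw t)
  have hsol := hw.isSmoothSolution hdec ha₀ ha two_pos.le haw hT.le hduh hmem
  refine ⟨_, _, hsol, ?_, ?_⟩
  · have h0 : a 0 = bumpData hm0 := by
      ext ξ
      rw [hduh 0 ⟨le_rfl, hT.le⟩ ξ]
      simp [duhamel]
    have h1 := hsol.initial
    rw [← Lp.toTemperedDistribution_toLp_eq (p := 2), ← h1, sobolevENorm_ofFourier _
      (hdec.memLp_weighted hw.pos s (hac 0) (haw 0)), h0]
    exact eLpNorm_bumpData_le hm hs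
  · rw [sobolevENorm_ofFourier _ (hdec.memLp_weighted hw.pos s (hac t) (haw t))]
    refine le_eLpNorm_of_low_frequency hm hs (by have := ht.1; positivity) fun ξ hξ => ?_
    refine le_trans (le_of_eq (by ring)) (le_norm_duhamel_solution hm hw hmw ha haw hduh ht ht' hξ ?_)
    have hwD : w ξ ≤ D * m ^ 3 := (combWeight_le hK0 hN0 ξ).trans_eq (by rw [hK, hD]; ring)
    calc 12 * κ ^ 2 * T * w ξ ≤ 12 * κ ^ 2 * T * (D * m ^ 3) := by gcongr
      _ = (12288 * Real.pi ^ 2 * D ^ 3 * T) * m / 4 := by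
          rw [hκm]; field_simp; ring
      _ ≤ m * m / 4 := by gcongr
      _ = m ^ 2 / 4 := by ring

/-- Arbitrarily small data in `H^s` whose solutions are bounded below in `H^s` at a fixed time. -/
lemma exists_small_data_large_solution {s : ℝ} (hs : s < -(1 / 4)) {T : ℝ} (hT : 0 < T) :
    ∃ c : ℝ≥0∞, 0 < c ∧ ∃ t ∈ Icc 0 T, ∀ δ : ℝ≥0∞, 0 < δ →
      ∃ (u₀ : 𝓢(ℝ, ℂ)) (u : ℝ → Lp ℂ 2 (volume : Measure ℝ)), IsSmoothSolution T u₀ u ∧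
        sobolevENorm s (u₀ : 𝓢'(ℝ, ℂ)) < δ ∧
        c < sobolevENorm s (Lp.toTemperedDistribution (u t)) := by
  set t : ℝ := min T (1 / 160) with ht_def
  have ht0 : 0 < t := lt_min hT (by norm_num)
  have ht : t ∈ Icc 0 T := ⟨ht0.le, min_le_left _ _⟩
  have hpos : 0 < ENNReal.ofReal (2 ^ (s / 2) * (t / 4)) := ENNReal.ofReal_pos.2 (by positivity)
  obtain ⟨c, hc0, hc⟩ := exists_between hpos
  refine ⟨c, hc0, t, ht, fun δ hδ => ?_⟩
  have hlim : Tendsto (fun m : ℝ => ENNReal.ofReal (2 ^ (1 - s) * m ^ (1 + 4 * s))) atTop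
      (𝓝 0) := by
    have h1 := (tendsto_rpow_neg_atTop (y := -(1 + 4 * s)) (by linarith)).const_mul
      ((2 : ℝ) ^ (1 - s))
    simp only [neg_neg, mul_zero] at h1
    simpa using ENNReal.tendsto_ofReal h1
  obtain ⟨m, ⟨u₀, u, hu, hu₀, hut⟩, hm⟩ :=
    ((exists_isSmoothSolution_bumpData (s := s) (by linarith) hT ht (min_le_right _ _)).and
      (hlim.eventually_lt_const hδ)).exists
  exact ⟨u₀, u, hu, hu₀.trans_lt hm, hc.trans_le hut⟩

/-! ### The zero solution and the two failures of continuity -/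

lemma besselPotential_zero_apply (s : ℝ) :
    besselPotential ℝ ℂ s 0 = Lp.toTemperedDistribution (0 : Lp ℂ 2 (volume : Measure ℝ)) :=
  (map_zero _).trans (map_zero (Lp.toTemperedDistributionCLM ℂ (volume : Measure ℝ) 2)).symm

lemma toTemperedDistribution_zero :
    Lp.toTemperedDistribution (0 : Lp ℂ 2 (volume : Measure ℝ)) = 0 :=
  map_zero (Lp.toTemperedDistributionCLM ℂ (volume : Measure ℝ) 2)

lemma sobolevENorm_zero (s : ℝ) : sobolevENorm s 0 = 0 := by
  rw [sobolevENorm_eq_enorm (besselPotential_zero_apply s), enorm_zero]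

lemma isSmoothSolution_zero (T : ℝ) : IsSmoothSolution T 0 fun _ => 0 where
  regular σ t _ := by
    refine ⟨?_, ?_⟩
    · rw [toTemperedDistribution_zero]
      exact memSobolev_fun_zero ℝ ℂ σ 2
    · simpa [sobolevENorm_zero] using tendsto_const_nhds
  initial := (map_zero (SchwartzMap.toLpCLM ℂ (E := ℝ) ℂ 2 volume)).symm
  equation φ t _ := by
    have h : ∀ ψ : ℝ → ℂ, ∫ x, (0 : Lp ℂ 2 (volume : Measure ℝ)) x * ψ x = 0 := fun ψ => by
      refine integral_eq_zero_of_ae ?_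
      filter_upwards [Lp.coeFn_zero ℂ 2 (volume : Measure ℝ)] with x hx
      rw [hx, Pi.zero_apply, zero_mul]
    simp_rw [mul_assoc, h]
    simpa using hasDerivWithinAt_const t (Icc 0 T) (0 : ℂ)

lemma schwartz_zero_toTemperedDistribution : ((0 : 𝓢(ℝ, ℂ)) : 𝓢'(ℝ, ℂ)) = 0 :=
  map_zero (SchwartzMap.toTemperedDistributionCLM ℝ ℂ volume)

theorem not_solutionOperatorUniformlyContinuous {s : ℝ} (hs : s < -(1 / 4)) {T : ℝ} (hT : 0 < T)
    {R : ℝ≥0∞} (hR : 0 < R) : ¬ SolutionOperatorUniformlyContinuous s T R := by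
  intro h
  obtain ⟨c, hc, t, ht, hex⟩ := exists_small_data_large_solution hs hT
  obtain ⟨δ, hδ, hδc⟩ := h c hc
  obtain ⟨u₀, u, hu, hu₀, hut⟩ := hex (min δ R) (lt_min hδ hR)
  have h1 := hδc u₀ 0 u _ hu (isSmoothSolution_zero T) (hu₀.le.trans (min_le_right _ _))
    (by rw [schwartz_zero_toTemperedDistribution, sobolevENorm_zero]; exact hR.le)
    (by
      rw [schwartz_zero_toTemperedDistribution, sub_zero]
      exact hu₀.trans_le (min_le_left _ _)) t ht
  rw [toTemperedDistribution_zero, sub_zero] at h1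
  exact absurd h1 (not_le.2 hut)

theorem not_locallyWellPosed {s : ℝ} (hs : s < -(1 / 4)) : ¬ LocallyWellPosed s := by
  intro h
  obtain ⟨r, hr, T, hT, Φ, -, hcont, hsol⟩ := h 0 (memSobolev_fun_zero ℝ ℂ s 2)
  obtain ⟨c, hc, t, ht, hex⟩ := exists_small_data_large_solution hs hT
  simp only [sub_zero] at hcont hsol
  obtain ⟨δ, hδ, hδc⟩ := hcont 0 (by rwa [sobolevENorm_zero]) c hc
  obtain ⟨u₀, u, hu, hu₀, hut⟩ := hex (min δ r) (lt_min hδ hr)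
  have hu₀r := hu₀.trans_le (min_le_right _ _)
  have h1 := hδc u₀ hu₀r (by rw [sub_zero]; exact hu₀.trans_le (min_le_left _ _)) t ht
  -- The uniqueness contained in well-posedness identifies `Φ` with the constructed solutions, so no
  -- separate uniqueness theorem is needed.
  have h2 := (hsol u₀ hu₀r).2 u hu t ht
  have h3 := (hsol 0 (by rwa [schwartz_zero_toTemperedDistribution, sobolevENorm_zero])).2 _
    (isSmoothSolution_zero T) t ht
  rw [schwartz_zero_toTemperedDistribution, toTemperedDistribution_zero] at h3
  rw [← h2, ← h3, sub_zero] at h1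
  exact absurd h1 (not_le.2 hut)

end

theorem theorem1p1 (s : ℝ) (hs : s < -(1 / 4)) :
    ¬ LocallyWellPosed s ∧
      ∀ T : ℝ, 0 < T → ∀ R : ℝ≥0∞, 0 < R → ¬ SolutionOperatorUniformlyContinuous s T R :=
  ⟨not_locallyWellPosed hs, fun _ hT _ hR => not_solutionOperatorUniformlyContinuous hs hT hR⟩
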